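/- **Setting.** Matrices have entries in $\mathbb R_+=[0,\infty)$ and are multiplied in max algebra: $(A\otimes B)_{ij}=\max_k a_{ik}b_{kj}$; all powers below are max-algebraic, with $A^0=I$. Let $A\in\mathbb R_+^{n\times n}$, $n\ge 1$. Its digraph $\mathcal D(A)$ has nodes $1,\dots,n$ and an edge $(i,j)$ whenever $a_{ij}\ne 0$. Node $i$ has access to node $j$ if there is a path, possibly of length $0$, from $i$ to $j$; the components of $\mathcal D(A)$ are the classes of mutual access (including trivial ones, whose only node lies on no cycle). The weight $w(P)$ of a cycle $P$ of length $k\ge1$ is the product of the entries along its edges; $\lambda(A)$ is the maximum of $w(P)^{1/k}$ over all cycles ($0$ if there are none), and the critical digraph consists of the nodes and edges of the cycles that attain it. The cyclicity of a strongly connected digraph is the g.c.d. of the lengths of its simple cycles; that of a disjoint union of strongly connected digraphs is the l.c.m. of the cyclicities of its components. Put $K_1=\{1,\dots,n\}$. Given $K_\mu$, let $A_\mu$ be $A$ with all entries outside $K_\mu\times K_\mu$ replaced by $0$, and $\lambda_\mu=\lambda(A_\mu)$. If $\lambda_\mu=0$, stop; otherwise let $(N_\mu,E_\mu)$ be the critical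 digraph of $A_\mu$, $\gamma_\mu$ its cyclicity, $M_\mu$ the union of the components of $\mathcal D(A)$ that meet $N_\mu$, and $K_{\mu+1}=K_\mu\setminus M_\mu$. Let $\Sigma$ be the set of those $\mu$ with $\lambda_\mu\neq0$ (so the $\lambda_\mu$, $\mu\in\Sigma$, are strictly decreasing), and $\gamma=\operatorname{lcm}_{\mu\in\Sigma}\gamma_\mu$ (equal to $1$ if $\Sigma=\emptyset$). For $\mu\in\Sigma$ let $B_\mu=\bigoplus_{s\ge0}\big((A_\mu/\lambda_\mu)^{\gamma_\mu}\big)^s$, where $\oplus$ is the entrywise maximum; let $C_\mu$ (respectively $R_\mu$) be $B_\mu$ with all columns (respectively rows) outside $N_\mu$ replaced by $0$, let $S_\mu$ be $A_\mu/\lambda_\mu$ with all entries outside $E_\mu$ replaced by $0$, and $U_\mu^{(1)}=C_\mu\otimes S_\mu\otimes R_\mu$. The matrix $A$ is *orbit periodic* if for every $y\in\mathbb R_+^n$ there is $\lambda(y)\in\mathbb R_+$ such that $A^{t+\gamma}\otimes y=\lambda(y)^{\gamma}\,(A^t\otimes y)$ for all sufficiently large $t$. **Theorem.** There are a single algorithm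 and a constant $\kappa$ such that the following holds for all $n\ge1$ and all $A\in\mathbb R_+^{n\times n}$. Suppose the algorithm is given $n$, $A$, the components of $\mathcal D(A)$ (the number of components and the component number of each node), the access relation between components (as a table of zeros and ones), the number of elements of $\Sigma$, and $\lambda_\mu$ and $U_\mu^{(1)}$ for all $\mu\in\Sigma$. Then it halts after at most $\kappa n^3$ operations, and its output is $1$ if $A$ is orbit periodic and $0$ otherwise. Here an algorithm is a finite program, independent of $n$ and of $A$, for a unit-cost random access machine with registers and arrays for natural numbers (constants, copying, increment, decrement, comparison, and use as array indices) and for nonnegative real numbers (constants $0$ and $1$, copying, maximum, product, comparison); every such elementary operation and every comparison counts as one operation. -/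

import Mathlib

open scoped NNReal

noncomputable section

/-! Max-times algebra of nonnegative matrices -/

namespace MaxAlg

/-- Square matrices with nonnegative real entries. -/
abbrev Mat (n : ℕ) := Matrix (Fin n) (Fin n) ℝ≥0

/-- The max-algebraic product: `(A ⊗ B) i j = max_k (A i k * B k j)`. -/
def mmul {n : ℕ} (A B : Mat n) : Mat n :=
  fun i j => Finset.univ.sup fun k => A i k * B k j

/-- The max-algebraic power, starting with the identity matrix. -/
def mpow {n : ℕ} (A : Mat n) : ℕ → Mat n
  | 0 => 1
  | t + 1 => mmul (mpow A t) A

/-- The max-algebraic matrix-vector product. -/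
def mvec {n : ℕ} (A : Mat n) (y : Fin n → ℝ≥0) : Fin n → ℝ≥0 :=
  fun i => Finset.univ.sup fun k => A i k * y k

/-- The Kleene star `I ⊕ A ⊕ A² ⊕ ⋯` (meaningful when the series is bounded, that is, when the
maximum cycle geometric mean of `A` is at most one; it is only used in that case). -/
def star {n : ℕ} (A : Mat n) : Mat n :=
  fun i j => ⨆ t : ℕ, mpow A t i j

/-! Digraphs on the nodes `Fin n`, given by their edge relation -/

/-- `(c 0, c 1, …, c k)` with `c k = c 0` is a cycle of length `k ≥ 1` in the digraph `E`. -/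
def IsCycle {n : ℕ} (E : Fin n → Fin n → Prop) (k : ℕ) (c : ℕ → Fin n) : Prop :=
  0 < k ∧ c k = c 0 ∧ ∀ t < k, E (c t) (c (t + 1))

/-- A cycle is simple if it does not repeat a node (apart from its end point). -/
def IsSimpleCycle {n : ℕ} (E : Fin n → Fin n → Prop) (k : ℕ) (c : ℕ → Fin n) : Prop :=
  IsCycle E k c ∧ Set.InjOn c (Set.Iio k)

/-- `i` has access to `j`: there is a path (possibly of length zero) from `i` to `j`. -/
def Access {n : ℕ} (E : Fin n → Fin n → Prop) (i j : Fin n) : Prop :=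
  Relation.ReflTransGen E i j

/-- `i` and `j` lie in the same component of the digraph. -/
def SameComp {n : ℕ} (E : Fin n → Fin n → Prop) (i j : Fin n) : Prop :=
  Access E i j ∧ Access E j i

/-- `i` is an end point of an edge of `E`. -/
def IsNode {n : ℕ} (E : Fin n → Fin n → Prop) (i : Fin n) : Prop :=
  ∃ j, E i j ∨ E j i

open Classical in
/-- The cyclicity of the component of `i` in `E`: the g.c.d. of the lengths of its simple cycles
(a simple cycle has length at most `n`). -/
def compCyclicity {n : ℕ} (E : Fin n → Fin n → Prop) (i : Fin n) : ℕ :=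
  ((Finset.Icc 1 n).filter fun k => ∃ c, IsSimpleCycle E k c ∧ SameComp E (c 0) i).gcd id

open Classical in
/-- The cyclicity of a digraph consisting of disjoint strongly connected components: the l.c.m. of
the cyclicities of the components. -/
def cyclicity {n : ℕ} (E : Fin n → Fin n → Prop) : ℕ :=
  (Finset.univ.filter fun i => IsNode E i).lcm fun i => compCyclicity E i

/-! The digraph of a matrix, its maximum cycle geometric mean and its critical digraph -/

/-- The edges of the digraph associated with `A`. -/
def Edge {n : ℕ} (A : Mat n) (i j : Fin n) : Prop := A i j ≠ 0

/-- The weight of the path `(c 0, …, c k)`. -/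
def weight {n : ℕ} (A : Mat n) (k : ℕ) (c : ℕ → Fin n) : ℝ≥0 :=
  ∏ t ∈ Finset.range k, A (c t) (c (t + 1))

/-- The geometric mean `w(P)^(1/k)` of the cycle `P = (c 0, …, c k)`. -/
def cycleMean {n : ℕ} (A : Mat n) (k : ℕ) (c : ℕ → Fin n) : ℝ≥0 :=
  weight A k c ^ (1 / (k : ℝ))

/-- The maximum cycle geometric mean of `A`, taken over the cycles of length at most `n`;
it is `0` if there is no cycle. -/
def mcgm {n : ℕ} (A : Mat n) : ℝ≥0 :=
  sSup {x | ∃ k c, k ≤ n ∧ IsCycle (Edge A) k c ∧ x = cycleMean A k c}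

/-- The edges of the critical digraph: those lying on a cycle whose geometric mean is maximal. -/
def CritEdge {n : ℕ} (A : Mat n) (i j : Fin n) : Prop :=
  ∃ k c, IsCycle (Edge A) k c ∧ cycleMean A k c = mcgm A ∧ ∃ t < k, c t = i ∧ c (t + 1) = j

/-! `CSR` products -/

/-- Entrywise division by a scalar. -/
def scale {n : ℕ} (A : Mat n) (l : ℝ≥0) : Mat n := fun i j => A i j / l

/-- The star `(A ^ γ)*`, where `γ` is the cyclicity of the digraph `E`. -/
def csrB {n : ℕ} (A : Mat n) (E : Fin n → Fin n → Prop) : Mat n :=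
  star (mpow A (cyclicity E))

open Classical in
/-- The columns of `csrB` at nodes of `E`, zero elsewhere. -/
def csrC {n : ℕ} (A : Mat n) (E : Fin n → Fin n → Prop) : Mat n :=
  fun i j => if IsNode E j then csrB A E i j else 0

open Classical in
/-- The rows of `csrB` at nodes of `E`, zero elsewhere. -/
def csrR {n : ℕ} (A : Mat n) (E : Fin n → Fin n → Prop) : Mat n :=
  fun i j => if IsNode E i then csrB A E i j else 0

open Classical in
/-- The entries of `A` on the edges of `E`, zero elsewhere. -/
def csrS {n : ℕ} (A : Mat n) (E : Fin n → Fin n → Prop) : Mat n :=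
  fun i j => if E i j then A i j else 0

/-- The product `C ⊗ S ^ t ⊗ R`. -/
def csr {n : ℕ} (A : Mat n) (E : Fin n → Fin n → Prop) (t : ℕ) : Mat n :=
  mmul (mmul (csrC A E) (mpow (csrS A E) t)) (csrR A E)

/-! The ultimate expansion. Its terms are numbered `0, 1, …, ultCount A - 1`, by strictly
decreasing values of `ultLambda`. -/

open Classical in
/-- `A` with all entries outside of `K × K` replaced by zero. -/
def restrict {n : ℕ} (A : Mat n) (K : Set (Fin n)) : Mat n :=
  fun i j => if i ∈ K ∧ j ∈ K then A i j else 0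

/-- The nodes that remain after `μ` steps: each step removes all components of the digraph of `A`
that contain a critical node of the current restriction of `A`. -/
def ultK {n : ℕ} (A : Mat n) : ℕ → Set (Fin n)
  | 0 => Set.univ
  | μ + 1 => ultK A μ \
      {i | ∃ k, IsNode (CritEdge (restrict A (ultK A μ))) k ∧ SameComp (Edge A) i k}

/-- The restriction `A_μ` of `A` to the remaining nodes. -/
def ultA {n : ℕ} (A : Mat n) (μ : ℕ) : Mat n := restrict A (ultK A μ)

/-- The value `λ_μ`. -/
def ultLambda {n : ℕ} (A : Mat n) (μ : ℕ) : ℝ≥0 := mcgm (ultA A μ)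

/-- The number of terms: the construction ends at the first `μ` with `λ_μ = 0`. -/
def ultCount {n : ℕ} (A : Mat n) : ℕ := sInf {μ | ultLambda A μ = 0}

/-- The matrix `U_μ^(t)`. -/
def ultU {n : ℕ} (A : Mat n) (μ t : ℕ) : Mat n :=
  csr (scale (ultA A μ) (ultLambda A μ)) (CritEdge (ultA A μ)) t

/-- The l.c.m. of the cyclicities of the critical digraphs of all terms. -/
def ultGamma {n : ℕ} (A : Mat n) : ℕ :=
  (Finset.range (ultCount A)).lcm fun μ => cyclicity (CritEdge (ultA A μ))

/-- Orbit periodicity: every orbit `A ^ t ⊗ y` is ultimately linear periodic. -/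
def OrbitPeriodic {n : ℕ} (A : Mat n) : Prop :=
  ∀ y : Fin n → ℝ≥0, ∃ l : ℝ≥0, ∀ᶠ t in Filter.atTop,
    mvec (mpow A (t + ultGamma A)) y = l ^ ultGamma A • mvec (mpow A t) y

/-- `comp` numbers the components of the digraph of `A` (trivial ones included) by
`0, …, c - 1`. -/
def IsComponentNumbering {n c : ℕ} (A : Mat n) (comp : Fin n → Fin c) : Prop :=
  Function.Surjective comp ∧ ∀ i j, comp i = comp j ↔ SameComp (Edge A) i j

end MaxAlg

/-! A random access machine with unit costs. It works on natural numbers, used as indices and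
truth values, which can only be copied, compared, incremented and decremented, and on nonnegative
real numbers, with the operations of max algebra and comparisons. -/

namespace RAM

/-- Memory: registers for natural and for real numbers, two-dimensional arrays of natural
numbers, and three-dimensional arrays of real numbers. The first argument of `iarr` and `rarr` is
the number of the array. -/
structure State where
  ireg : ℕ → ℕ
  rreg : ℕ → ℝ≥0
  iarr : ℕ → ℕ → ℕ → ℕ
  rarr : ℕ → ℕ → ℕ → ℕ → ℝ≥0

/-- Elementary operations. Arguments are numbers of registers, except for the literal in `constI`
and for the number `a` of an array in the load and store operations. -/
inductive Op where
  | constI (r v : ℕ)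
  | copyI (r s : ℕ)
  | succI (r : ℕ)
  | predI (r : ℕ)
  | loadI (r a p q : ℕ)
  | storeI (a p q r : ℕ)
  | zeroR (x : ℕ)
  | oneR (x : ℕ)
  | copyR (x y : ℕ)
  | maxR (x y z : ℕ)
  | mulR (x y z : ℕ)
  | loadR (x a p q r : ℕ)
  | storeR (a p q r x : ℕ)

/-- Assignment to a register for natural numbers. -/
def State.setI (s : State) (r v : ℕ) : State :=
  { s with ireg := Function.update s.ireg r v }

/-- Assignment to a register for real numbers. -/
def State.setR (s : State) (x : ℕ) (v : ℝ≥0) : State :=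
  { s with rreg := Function.update s.rreg x v }

/-- The effect of an elementary operation. -/
def Op.run : Op → State → State
  | .constI r v, s => s.setI r v
  | .copyI r r', s => s.setI r (s.ireg r')
  | .succI r, s => s.setI r (s.ireg r + 1)
  | .predI r, s => s.setI r (s.ireg r - 1)
  | .loadI r a p q, s => s.setI r (s.iarr a (s.ireg p) (s.ireg q))
  | .storeI a p q r, s =>
      { s with iarr := fun b i j =>
          if b = a ∧ i = s.ireg p ∧ j = s.ireg q then s.ireg r else s.iarr b i j }
  | .zeroR x, s => s.setR x 0
  | .oneR x, s => s.setR x 1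
  | .copyR x y, s => s.setR x (s.rreg y)
  | .maxR x y z, s => s.setR x (max (s.rreg y) (s.rreg z))
  | .mulR x y z, s => s.setR x (s.rreg y * s.rreg z)
  | .loadR x a p q r, s => s.setR x (s.rarr a (s.ireg p) (s.ireg q) (s.ireg r))
  | .storeR a p q r x, s =>
      { s with rarr := fun b i j k =>
          if b = a ∧ i = s.ireg p ∧ j = s.ireg q ∧ k = s.ireg r then s.rreg x
          else s.rarr b i j k }

/-- Comparisons of the contents of two registers. -/
inductive Test where
  | ltI (r s : ℕ)
  | eqI (r s : ℕ)
  | ltR (x y : ℕ)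
  | eqR (x y : ℕ)

/-- The outcome of a comparison. -/
def Test.Holds : Test → State → Prop
  | .ltI r r', s => s.ireg r < s.ireg r'
  | .eqI r r', s => s.ireg r = s.ireg r'
  | .ltR x y, s => s.rreg x < s.rreg y
  | .eqR x y, s => s.rreg x = s.rreg y

/-- Programs. A program is a finite text, the same for all inputs of all sizes. -/
inductive Prog where
  | skip
  | op (o : Op)
  | seq (p q : Prog)
  | ite (b : Test) (p q : Prog)
  | loop (b : Test) (p : Prog)

/-- `Exec p s s' T`: started in the state `s`, the program `p` halts in the state `s'` after
exactly `T` steps, where each elementary operation and each comparison is one step. -/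
inductive Exec : Prog → State → State → ℕ → Prop where
  | skip (s : State) : Exec .skip s s 1
  | op (o : Op) (s : State) : Exec (.op o) s (o.run s) 1
  | seq {p q : Prog} {s s' s'' : State} {T T' : ℕ} :
      Exec p s s' T → Exec q s' s'' T' → Exec (.seq p q) s s'' (T + T')
  | ite_true {b : Test} {p q : Prog} {s s' : State} {T : ℕ} :
      b.Holds s → Exec p s s' T → Exec (.ite b p q) s s' (T + 1)
  | ite_false {b : Test} {p q : Prog} {s s' : State} {T : ℕ} :
      ¬ b.Holds s → Exec q s s' T → Exec (.ite b p q) s s' (T + 1)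
  | loop_done {b : Test} {p : Prog} {s : State} :
      ¬ b.Holds s → Exec (.loop b p) s s 1
  | loop_step {b : Test} {p : Prog} {s s' s'' : State} {T T' : ℕ} :
      b.Holds s → Exec p s s' T → Exec (.loop b p) s' s'' T' → Exec (.loop b p) s s'' (T + T' + 1)

/-- The machine is deterministic. -/
theorem Exec.unique {p : Prog} {s s₁ s₂ : State} {T₁ T₂ : ℕ}
    (h₁ : Exec p s s₁ T₁) (h₂ : Exec p s s₂ T₂) : s₁ = s₂ ∧ T₁ = T₂ := by
  induction h₁ generalizing s₂ T₂ with
  | skip s => cases h₂; exact ⟨rfl, rfl⟩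
  | op o s => cases h₂; exact ⟨rfl, rfl⟩
  | seq _ _ ih ih' =>
    cases h₂ with
    | seq k k' =>
      obtain ⟨rfl, rfl⟩ := ih k
      obtain ⟨rfl, rfl⟩ := ih' k'
      exact ⟨rfl, rfl⟩
  | ite_true hb _ ih =>
    cases h₂ with
    | ite_true _ k => obtain ⟨rfl, rfl⟩ := ih k; exact ⟨rfl, rfl⟩
    | ite_false hb' _ => exact absurd hb hb'
  | ite_false hb _ ih =>
    cases h₂ with
    | ite_true hb' _ => exact absurd hb' hb
    | ite_false _ k => obtain ⟨rfl, rfl⟩ := ih k; exact ⟨rfl, rfl⟩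
  | loop_done hb =>
    cases h₂ with
    | loop_done _ => exact ⟨rfl, rfl⟩
    | loop_step hb' _ _ => exact absurd hb' hb
  | loop_step hb _ _ ih ih' =>
    cases h₂ with
    | loop_done hb' => exact absurd hb hb'
    | loop_step _ k k' =>
      obtain ⟨rfl, rfl⟩ := ih k
      obtain ⟨rfl, rfl⟩ := ih' k'
      exact ⟨rfl, rfl⟩

end RAM

namespace MaxAlg

open Classical in
/-- The initial memory. Index registers `0, 1, 2` hold `n`, the number of components, and the
number of terms of the ultimate expansion. Array `0` of natural numbers holds the component of
each node, array `1` the access relation between components as a table of zeros and ones. Array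
`0` of real numbers holds `A`, array `1` the values `λ_μ`, and array `2` the matrices `U_μ^(1)`.
Everything else is zero. -/
def input {n c : ℕ} (A : Mat n) (comp : Fin n → Fin c) : RAM.State where
  ireg r :=
    if r = 0 then n else if r = 1 then c else if r = 2 then ultCount A else 0
  rreg _ := 0
  iarr a p q :=
    if a = 0 then (if h : p < n ∧ q = 0 then (comp ⟨p, h.1⟩ : ℕ) else 0)
    else if a = 1 then
      (if ∃ i j, (comp i : ℕ) = p ∧ (comp j : ℕ) = q ∧ Access (Edge A) i j then 1 else 0)
    else 0
  rarr a p q r :=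
    if a = 0 then (if h : p = 0 ∧ q < n ∧ r < n then A ⟨q, h.2.1⟩ ⟨r, h.2.2⟩ else 0)
    else if a = 1 then (if p < ultCount A ∧ q = 0 ∧ r = 0 then ultLambda A p else 0)
    else if a = 2 then
      (if h : p < ultCount A ∧ q < n ∧ r < n then ultU A p 1 ⟨q, h.2.1⟩ ⟨r, h.2.2⟩ else 0)
    else 0

end MaxAlg

end

/-!
Along a residue class of exponents, an entry `(i, j)` of the powers of `A` is either eventually zero
or grows at the rate `λ_ν`, where `ν` is the first term of the ultimate expansion whose critical
nodes lie on a walk from `i` to `j` with length in that class: as long as no critical node of an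
earlier term is met, all walks stay in `K_ν`, and closed walks in the critical digraph can be
inserted at will. Every entry of an orbit is a maximum of such sequences, so orbit periodicity says
that, for each set of starting nodes, all entries of the orbit that are not eventually zero share
one growth rate.

Reduced to length `1` modulo `γ`, this becomes a condition on the numbers `g i j`, the first `ν` for
which `U_ν^(1)` has a nonzero entry at `(i, j)` (or the number of terms if there is none): whenever
`g i k` is less than the number of terms and `g i' j < g i k`, also `g i j ≤ g i' j`. Here `i'` may
be taken to minimise `g i' j`, so that checking the triples `(i, j, k)` suffices, and this takes
cubic time.
-/

/-- The filter of the large `t` in the residue class of `r` modulo `d`. -/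
def atTopMod (r d : ℕ) : Filter ℕ := Filter.atTop ⊓ Filter.principal {t | t ≡ r [MOD d]}

section AtTopMod

variable {r d : ℕ} {p : ℕ → Prop}

theorem atTopMod_le (r d : ℕ) : atTopMod r d ≤ Filter.atTop := inf_le_left

theorem eventually_atTopMod :
    (∀ᶠ t in atTopMod r d, p t) ↔ ∀ᶠ t in Filter.atTop, t ≡ r [MOD d] → p t :=
  Filter.eventually_inf_principal

theorem atTopMod_neBot (hd : 0 < d) (r : ℕ) : (atTopMod r d).NeBot :=
  Filter.frequently_mem_iff_neBot.1 (Nat.frequently_modEq hd.ne' r)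

theorem tendsto_add_atTopMod (r d : ℕ) :
    Filter.Tendsto (fun t => t + d) (atTopMod r d) (atTopMod r d) :=
  (Filter.tendsto_add_atTop_nat d).inf <| Filter.tendsto_principal_principal.2 fun _ ht =>
    Nat.add_modEq_right.trans ht

theorem eventually_atTop_iff_atTopMod (hd : 0 < d) :
    (∀ᶠ t in Filter.atTop, p t) ↔ ∀ r, ∀ᶠ t in atTopMod r d, p t := by
  refine ⟨fun h r => atTopMod_le r d h, fun h => ?_⟩
  filter_upwards [(Filter.eventually_all_finset (Finset.range d)).2 fun r _ =>
    eventually_atTopMod.1 (h r)] with t ht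
  exact ht (t % d) (Finset.mem_range.2 (Nat.mod_lt t hd)) (Nat.mod_modEq t d).symm

end AtTopMod

/-- The sequence `f` agrees along `l` with a geometric sequence of ratio `ρ` whose coefficient is
not zero; for `ρ = 0` this says that `f` is zero along `l`. -/
def EventuallyGeometric (l : Filter ℕ) (f : ℕ → ℝ≥0) (ρ : ℝ≥0) : Prop :=
  ∃ F ≠ 0, ∀ᶠ t in l, f t = F * ρ ^ t

section EventuallyGeometric

variable {l : Filter ℕ} {f g : ℕ → ℝ≥0} {ρ σ : ℝ≥0}

theorem eventuallyGeometric_zero_iff (hl : l ≤ Filter.atTop) :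
    EventuallyGeometric l f 0 ↔ ∀ᶠ t in l, f t = 0 := by
  have hpow : ∀ᶠ t : ℕ in l, (0 : ℝ≥0) ^ t = 0 :=
    hl ((Filter.eventually_ne_atTop 0).mono fun t ht => zero_pow ht)
  constructor
  · rintro ⟨F, -, h⟩
    filter_upwards [h, hpow] with t ht h0
    rw [ht, h0, mul_zero]
  · intro h
    refine ⟨1, one_ne_zero, ?_⟩
    filter_upwards [h, hpow] with t ht h0
    rw [ht, h0, mul_zero]

theorem EventuallyGeometric.congr (h : EventuallyGeometric l f ρ) (hfg : ∀ᶠ t in l, f t = g t) :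
    EventuallyGeometric l g ρ := by
  obtain ⟨F, hF, h⟩ := h
  refine ⟨F, hF, ?_⟩
  filter_upwards [h, hfg] with t ht heq
  rw [← heq, ht]

theorem EventuallyGeometric.mul_const (h : EventuallyGeometric l f ρ) {c : ℝ≥0} (hc : c ≠ 0) :
    EventuallyGeometric l (fun t => f t * c) ρ := by
  obtain ⟨F, hF, h⟩ := h
  refine ⟨F * c, mul_ne_zero hF hc, ?_⟩
  filter_upwards [h] with t ht
  rw [ht, mul_right_comm]

theorem eventually_mul_pow_le {F : ℝ≥0} (C : ℝ≥0) (h : ρ < σ) (hF : F ≠ 0) :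
    ∀ᶠ t : ℕ in Filter.atTop, C * ρ ^ t ≤ F * σ ^ t := by
  have hσ : 0 < σ := lt_of_le_of_lt zero_le h
  have ht : Filter.Tendsto (fun t : ℕ => C * (ρ / σ) ^ t) Filter.atTop (nhds 0) := by
    simpa using (NNReal.tendsto_pow_atTop_nhds_zero_of_lt_one ((div_lt_one hσ).2 h)).const_mul C
  filter_upwards [ht.eventually (gt_mem_nhds (pos_iff_ne_zero.2 hF))] with t ht
  rw [div_pow, ← mul_div_assoc, div_lt_iff₀ (pow_pos hσ t)] at ht
  exact ht.le

theorem EventuallyGeometric.sup (hl : l ≤ Filter.atTop) (hf : EventuallyGeometric l f ρ)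
    (hg : EventuallyGeometric l g σ) : EventuallyGeometric l (fun t => f t ⊔ g t) (ρ ⊔ σ) := by
  wlog h : ρ ≤ σ generalizing f g ρ σ
  · simpa only [sup_comm] using this hg hf (le_of_not_ge h)
  obtain ⟨F, hF, hf⟩ := hf
  obtain ⟨G, hG, hg⟩ := hg
  rw [sup_eq_right.2 h]
  rcases h.lt_or_eq with h | rfl
  · refine ⟨G, hG, ?_⟩
    filter_upwards [hf, hg, hl (eventually_mul_pow_le F h hG)] with t hf hg hle
    rw [hf, hg, sup_eq_right.2 hle]
  · refine ⟨F ⊔ G, ne_bot_of_le_ne_bot hF le_sup_left, ?_⟩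
    filter_upwards [hf, hg] with t hf hg
    rw [hf, hg, max_mul_of_nonneg _ _ zero_le]

theorem EventuallyGeometric.finset_sup {ι : Type*} {S : Finset ι} {f : ι → ℕ → ℝ≥0}
    {ρ : ι → ℝ≥0} (hl : l ≤ Filter.atTop) (h : ∀ j ∈ S, EventuallyGeometric l (f j) (ρ j)) :
    EventuallyGeometric l (fun t => S.sup fun j => f j t) (S.sup ρ) := by
  classical
  induction S using Finset.induction_on with
  | empty => exact (eventuallyGeometric_zero_iff hl).2 (Filter.Eventually.of_forall fun _ => rfl)
  | insert j S _ ih =>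
    simp only [Finset.sup_insert]
    exact (h j (Finset.mem_insert_self j S)).sup hl
      (ih fun k hk => h k (Finset.mem_insert_of_mem hk))

theorem EventuallyGeometric.eventually_add_eq_iff {r d : ℕ} (hd : 0 < d)
    (h : EventuallyGeometric (atTopMod r d) f ρ) (c : ℝ≥0) :
    (∀ᶠ t in atTopMod r d, f (t + d) = c ^ d * f t) ↔ ρ = 0 ∨ c = ρ := by
  have hshift : ∀ {p : ℕ → Prop}, (∀ᶠ t in atTopMod r d, p t) → ∀ᶠ t in atTopMod r d, p (t + d) :=
    fun hp => (tendsto_add_atTopMod r d).eventually hp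
  rcases eq_or_ne ρ 0 with rfl | hρ
  · have h0 := (eventuallyGeometric_zero_iff (atTopMod_le r d)).1 h
    simp only [true_or, iff_true]
    filter_upwards [h0, hshift h0] with t ht ht'
    rw [ht, ht', mul_zero]
  obtain ⟨F, hF, h⟩ := h
  simp only [hρ, false_or]
  constructor
  · intro hc
    have := atTopMod_neBot hd r
    obtain ⟨t, ht, ht', hct⟩ := (h.and ((hshift h).and hc)).exists
    rw [ht, ht', pow_add, ← mul_assoc, mul_comm (c ^ d)] at hct
    exact ((pow_left_inj₀ zero_le zero_le hd.ne').1
      (mul_left_cancel₀ (mul_ne_zero hF (pow_ne_zero t hρ)) hct)).symm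
  · rintro rfl
    filter_upwards [h, hshift h] with t ht ht'
    rw [ht, ht', pow_add]
    ring

end EventuallyGeometric

/-- The least `ν < m` with `p ν`, or `m` if there is none. -/
noncomputable def leastBelow (m : ℕ) (p : ℕ → Prop) : ℕ := sInf {ν | m ≤ ν ∨ p ν}

section LeastBelow

variable {m ν : ℕ} {p q : ℕ → Prop}

theorem leastBelow_le (m : ℕ) (p : ℕ → Prop) : leastBelow m p ≤ m := Nat.sInf_le (Or.inl le_rfl)

theorem leastBelow_le_of (h : p ν) : leastBelow m p ≤ ν := Nat.sInf_le (Or.inr h)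

theorem leastBelow_spec (h : leastBelow m p < m) : p (leastBelow m p) :=
  (Nat.sInf_mem (s := {ν | m ≤ ν ∨ p ν}) ⟨m, Or.inl le_rfl⟩).resolve_left h.not_ge

theorem not_of_lt_leastBelow (h : ν < leastBelow m p) : ¬ p ν :=
  fun hp => h.not_ge (leastBelow_le_of hp)

theorem leastBelow_le_leastBelow (h : leastBelow m q < m → p (leastBelow m q)) :
    leastBelow m p ≤ leastBelow m q :=
  (leastBelow_le m q).lt_or_eq.elim (fun hq => leastBelow_le_of (h hq))
    fun hq => (leastBelow_le m p).trans_eq hq.symm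

theorem leastBelow_congr (h : ∀ ν < m, (p ν ↔ q ν)) : leastBelow m p = leastBelow m q :=
  le_antisymm (leastBelow_le_leastBelow fun hq => (h _ hq).2 (leastBelow_spec hq))
    (leastBelow_le_leastBelow fun hp => (h _ hp).1 (leastBelow_spec hp))

theorem fold_min_eq_leastBelow (m : ℕ) (p : ℕ → Prop) [DecidablePred p] :
    (Finset.range m).fold min m (fun ν => if p ν then ν else m) = leastBelow m p := by
  refine le_antisymm ?_ (Finset.le_fold_min _ |>.2 ⟨leastBelow_le m p, fun ν _ => ?_⟩)
  · rcases (leastBelow_le m p).lt_or_eq with h | h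
    · exact Finset.fold_min_le _ |>.2
        (Or.inr ⟨_, Finset.mem_range.2 h, by rw [if_pos (leastBelow_spec h)]⟩)
    · exact Finset.fold_min_le _ |>.2 (Or.inl h.ge)
  · split_ifs with hp
    exacts [leastBelow_le_of hp, leastBelow_le m p]

theorem fold_min_indicator_not (N : ℕ) (p : ℕ → Prop) [DecidablePred p]
    [Decidable (∃ k < N, p k)] :
    (Finset.range N).fold min 1 (fun k => if p k then 0 else 1) =
      if ∃ k < N, p k then 0 else 1 := by
  split_ifs with h
  · obtain ⟨k, hk, hp⟩ := h
    exact Nat.le_zero.1 (Finset.fold_min_le _ |>.2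
      (Or.inr ⟨k, Finset.mem_range.2 hk, by rw [if_pos hp]⟩))
  · refine le_antisymm (Finset.fold_min_le _ |>.2 (Or.inl le_rfl))
      (Finset.le_fold_min _ |>.2 ⟨le_rfl, fun k hk => ?_⟩)
    rw [if_neg fun hp => h ⟨k, Finset.mem_range.1 hk, hp⟩]

end LeastBelow

namespace MaxAlg

variable {n : ℕ}

theorem mul_le_mmul (A B : Mat n) (i k j : Fin n) : A i k * B k j ≤ mmul A B i j :=
  Finset.le_sup (f := fun k => A i k * B k j) (Finset.mem_univ k)

theorem mmul_le_iff {A B : Mat n} {i j : Fin n} {x : ℝ≥0} :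
    mmul A B i j ≤ x ↔ ∀ k, A i k * B k j ≤ x := by
  simp [mmul]

theorem exists_mmul_eq (A B : Mat n) (i j : Fin n) : ∃ k, mmul A B i j = A i k * B k j := by
  obtain ⟨k, -, hk⟩ := Finset.exists_mem_eq_sup Finset.univ ⟨i, Finset.mem_univ i⟩
    (fun k => A i k * B k j)
  exact ⟨k, hk⟩

theorem mmul_ne_zero_iff {A B : Mat n} {i j : Fin n} :
    mmul A B i j ≠ 0 ↔ ∃ k, A i k ≠ 0 ∧ B k j ≠ 0 := by
  simp only [← pos_iff_ne_zero, mmul, Finset.lt_sup_iff, Finset.mem_univ, true_and,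
    CanonicallyOrderedAdd.mul_pos]

theorem mmul_mono {A A' B B' : Mat n} (hA : ∀ i j, A i j ≤ A' i j) (hB : ∀ i j, B i j ≤ B' i j)
    (i j : Fin n) : mmul A B i j ≤ mmul A' B' i j :=
  mmul_le_iff.2 fun k => (mul_le_mul' (hA i k) (hB k j)).trans (mul_le_mmul A' B' i k j)

theorem mmul_one (A : Mat n) : mmul A 1 = A := by
  refine Matrix.ext fun i j => ?_
  refine le_antisymm (mmul_le_iff.2 fun k => ?_) ?_
  · rcases eq_or_ne k j with rfl | hkj
    · simp
    · simp [Matrix.one_apply_ne hkj]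
  · simpa using mul_le_mmul A 1 i j j

theorem one_mmul (A : Mat n) : mmul 1 A = A := by
  refine Matrix.ext fun i j => ?_
  refine le_antisymm (mmul_le_iff.2 fun k => ?_) ?_
  · rcases eq_or_ne i k with rfl | hik
    · simp
    · simp [Matrix.one_apply_ne hik]
  · simpa using mul_le_mmul 1 A i i j

theorem mmul_assoc (A B C : Mat n) : mmul (mmul A B) C = mmul A (mmul B C) := by
  refine Matrix.ext fun i j => ?_
  simp only [mmul, NNReal.finset_sup_mul, NNReal.mul_finset_sup, mul_assoc]
  exact Finset.sup_comm _ _ _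

@[simp] theorem mpow_zero_self (A : Mat n) (i : Fin n) : mpow A 0 i i = 1 :=
  Matrix.one_apply_eq i

theorem eq_of_mpow_zero_ne_zero {A : Mat n} {i j : Fin n} (h : mpow A 0 i j ≠ 0) : i = j :=
  not_imp_comm.1 Matrix.one_apply_ne h

@[simp] theorem mpow_one (A : Mat n) : mpow A 1 = A := one_mmul A

theorem mpow_add (A : Mat n) (a b : ℕ) : mpow A (a + b) = mmul (mpow A a) (mpow A b) := by
  induction b with
  | zero => exact (mmul_one _).symm
  | succ b ih => exact (congrArg (mmul · A) ih).trans (mmul_assoc _ _ _)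

theorem mpow_mpow (A : Mat n) (d t : ℕ) : mpow (mpow A d) t = mpow A (d * t) := by
  induction t with
  | zero => rfl
  | succ t ih => exact (congrArg (mmul · (mpow A d)) ih).trans (mpow_add A (d * t) d).symm

theorem mpow_mul_le (A : Mat n) (a b : ℕ) (i k j : Fin n) :
    mpow A a i k * mpow A b k j ≤ mpow A (a + b) i j :=
  mpow_add A a b ▸ mul_le_mmul _ _ i k j

theorem mpow_add_ne_zero_iff {A : Mat n} {a b : ℕ} {i j : Fin n} :
    mpow A (a + b) i j ≠ 0 ↔ ∃ k, mpow A a i k ≠ 0 ∧ mpow A b k j ≠ 0 := by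
  rw [mpow_add, mmul_ne_zero_iff]

theorem mpow_add_ne_zero {A : Mat n} {a b : ℕ} {i k j : Fin n} (h₁ : mpow A a i k ≠ 0)
    (h₂ : mpow A b k j ≠ 0) : mpow A (a + b) i j ≠ 0 :=
  mpow_add_ne_zero_iff.2 ⟨k, h₁, h₂⟩

theorem mpow_mul_self_ne_zero {A : Mat n} {a : ℕ} {i : Fin n} (h : mpow A a i i ≠ 0) (m : ℕ) :
    mpow A (m * a) i i ≠ 0 := by
  induction m with
  | zero => simp
  | succ m ih => rw [Nat.succ_mul]; exact mpow_add_ne_zero ih h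

theorem mpow_mono {A B : Mat n} (h : ∀ i j, A i j ≤ B i j) (t : ℕ) (i j : Fin n) :
    mpow A t i j ≤ mpow B t i j := by
  induction t generalizing i j with
  | zero => exact le_rfl
  | succ t ih => exact mmul_mono ih h i j

theorem mpow_ne_zero_of_le {A B : Mat n} (h : ∀ i j, A i j ≤ B i j) {t : ℕ} {i j : Fin n}
    (ht : mpow A t i j ≠ 0) : mpow B t i j ≠ 0 :=
  ne_bot_of_le_ne_bot ht (mpow_mono h t i j)

theorem access_iff {A : Mat n} {i j : Fin n} :
    Access (Edge A) i j ↔ ∃ t, mpow A t i j ≠ 0 := by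
  constructor
  · intro h
    induction h with
    | refl => exact ⟨0, by simp⟩
    | tail _ he ih =>
      obtain ⟨t, ht⟩ := ih
      exact ⟨t + 1, mmul_ne_zero_iff.2 ⟨_, ht, he⟩⟩
  · rintro ⟨t, ht⟩
    induction t generalizing j with
    | zero => rw [eq_of_mpow_zero_ne_zero ht]; exact Relation.ReflTransGen.refl
    | succ t ih =>
      obtain ⟨k, h₁, h₂⟩ := mmul_ne_zero_iff.1 ht
      exact (ih h₁).tail h₂

theorem weight_succ (A : Mat n) (t : ℕ) (c : ℕ → Fin n) :
    weight A (t + 1) c = weight A t c * A (c t) (c (t + 1)) :=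
  Finset.prod_range_succ _ _

theorem weight_add (A : Mat n) (a b : ℕ) (c : ℕ → Fin n) :
    weight A (a + b) c = weight A a c * weight A b (fun s => c (a + s)) :=
  Finset.prod_range_add _ _ _

theorem weight_congr {A : Mat n} {t : ℕ} {c c' : ℕ → Fin n} (h : ∀ s ≤ t, c s = c' s) :
    weight A t c = weight A t c' :=
  Finset.prod_congr rfl fun s hs => by
    have hs := Finset.mem_range.1 hs
    rw [h s hs.le, h (s + 1) hs]

theorem weight_ne_zero_iff {A : Mat n} {t : ℕ} {c : ℕ → Fin n} :
    weight A t c ≠ 0 ↔ ∀ s < t, Edge A (c s) (c (s + 1)) := by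
  simp only [weight, Finset.prod_ne_zero_iff, Finset.mem_range, Edge]

theorem weight_le_mpow (A : Mat n) (t : ℕ) (c : ℕ → Fin n) :
    weight A t c ≤ mpow A t (c 0) (c t) := by
  induction t with
  | zero => simp [weight]
  | succ t ih =>
    rw [weight_succ]
    exact (mul_le_mul_left ih _).trans (mul_le_mmul _ _ _ _ _)

theorem weight_add_le_mul (A : Mat n) (a b : ℕ) (c : ℕ → Fin n) :
    weight A (a + b) c ≤ mpow A a (c 0) (c a) * mpow A b (c a) (c (a + b)) := by
  rw [weight_add]
  exact mul_le_mul' (weight_le_mpow A a c) (weight_le_mpow A b fun s => c (a + s))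

theorem exists_weight_eq {A : Mat n} {t : ℕ} {i j : Fin n} (h : mpow A t i j ≠ 0) :
    ∃ c : ℕ → Fin n, c 0 = i ∧ c t = j ∧ weight A t c = mpow A t i j := by
  induction t generalizing j with
  | zero =>
    obtain rfl := eq_of_mpow_zero_ne_zero h
    exact ⟨fun _ => i, rfl, rfl, by simp [weight]⟩
  | succ t ih =>
    obtain ⟨l, hl⟩ : ∃ l, mpow A (t + 1) i j = mpow A t i l * A l j := exists_mmul_eq _ _ _ _
    rw [hl] at h ⊢
    obtain ⟨c, h0, ht, hw⟩ := ih (left_ne_zero_of_mul h)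
    refine ⟨fun s => if s ≤ t then c s else j, by simpa using h0, by simp, ?_⟩
    rw [weight_succ, ← hw]
    congr 1
    · exact weight_congr fun s hs => if_pos hs
    · simp [ht]

theorem exists_lt_eq_and_modEq (c : ℕ → Fin n) {d : ℕ} (hd : 0 < d) :
    ∃ x y, x < y ∧ y ≤ n * d ∧ c x = c y ∧ x ≡ y [MOD d] := by
  obtain ⟨x, y, hxy, he⟩ := Fintype.exists_ne_map_eq_of_card_lt
    (fun s : Fin (n * d + 1) => (c s, (⟨s % d, Nat.mod_lt _ hd⟩ : Fin d))) (by simp)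
  wlog hlt : x < y generalizing x y
  · exact this y x hxy.symm he.symm (hxy.lt_or_gt.resolve_left hlt)
  simp only [Prod.mk.injEq, Fin.mk.injEq] at he
  exact ⟨x, y, hlt, Nat.lt_succ_iff.1 y.2, he⟩

theorem exists_mpow_le_cut {A : Mat n} {d t : ℕ} (hd : 0 < d) (ht : n * d ≤ t) (i j : Fin n) :
    ∃ a b e p, a + b + e = t ∧ 0 < b ∧ b ≤ n * d ∧ d ∣ b ∧
      mpow A t i j ≤ mpow A a i p * mpow A b p p * mpow A e p j := by
  have : 0 < n * d := Nat.mul_pos i.pos hd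
  by_cases h : mpow A t i j = 0
  · exact ⟨0, n * d, t - n * d, i, by omega, this, le_rfl, dvd_mul_left _ _, h ▸ zero_le⟩
  obtain ⟨c, rfl, rfl, hw⟩ := exists_weight_eq h
  obtain ⟨x, y, hxy, hy, hc, hmod⟩ := exists_lt_eq_and_modEq c hd
  obtain ⟨b, rfl⟩ := Nat.exists_eq_add_of_le hxy.le
  obtain ⟨e, rfl⟩ := Nat.exists_eq_add_of_le (hy.trans ht)
  refine ⟨x, b, e, c x, rfl, by omega, by omega,
    (Nat.modEq_zero_iff_dvd).1 (Nat.ModEq.add_left_cancel' x hmod.symm), ?_⟩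
  rw [← hw, weight_add]
  have h₁ := weight_add_le_mul A x b c
  have h₂ := weight_le_mpow A e fun s => c (x + b + s)
  rw [← hc] at h₁
  rw [Nat.add_zero, ← hc] at h₂
  exact mul_le_mul' h₁ h₂

/-! The maximum cycle geometric mean -/

theorem finite_cycleMeans (A : Mat n) :
    {x | ∃ k c, k ≤ n ∧ IsCycle (Edge A) k c ∧ x = cycleMean A k c}.Finite := by
  apply (Set.finite_range fun q : Fin (n + 1) × (Fin (n + 1) → Fin n) =>
    cycleMean A q.1 (fun s => q.2 ⟨min s n, by omega⟩)).subset
  rintro x ⟨k, c, hk, -, rfl⟩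
  refine ⟨(⟨k, by omega⟩, fun s => c s), ?_⟩
  exact congrArg (· ^ (1 / (k : ℝ)))
    (weight_congr fun s hs => congrArg c (min_eq_left (hs.trans hk)))

theorem cycleMean_pow (A : Mat n) {k : ℕ} (hk : 0 < k) (c : ℕ → Fin n) :
    cycleMean A k c ^ k = weight A k c := by
  rw [cycleMean, one_div, NNReal.rpow_inv_natCast_pow _ hk.ne']

theorem cycleMean_eq_iff (A : Mat n) {k : ℕ} (hk : 0 < k) (c : ℕ → Fin n) (x : ℝ≥0) :
    cycleMean A k c = x ↔ weight A k c = x ^ k := by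
  rw [← cycleMean_pow A hk, pow_left_inj₀ zero_le zero_le hk.ne']

theorem exists_isCycle_weight_eq {A : Mat n} {k : ℕ} (hk : 0 < k) {i : Fin n}
    (h : mpow A k i i ≠ 0) : ∃ c, c 0 = i ∧ IsCycle (Edge A) k c ∧ weight A k c = mpow A k i i := by
  obtain ⟨c, h0, hc, hw⟩ := exists_weight_eq h
  exact ⟨c, h0, ⟨hk, hc.trans h0.symm, weight_ne_zero_iff.1 (hw ▸ h)⟩, hw⟩

theorem mpow_diag_le_of_le (A : Mat n) {k : ℕ} (hkn : k ≤ n) (i : Fin n) :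
    mpow A k i i ≤ mcgm A ^ k := by
  rcases k.eq_zero_or_pos with rfl | hk
  · simp
  by_cases h : mpow A k i i = 0
  · exact h ▸ zero_le
  obtain ⟨c, -, hc, hw⟩ := exists_isCycle_weight_eq hk h
  rw [← hw, ← cycleMean_pow A hk]
  gcongr
  exact le_csSup (finite_cycleMeans A).bddAbove ⟨k, c, hkn, hc, rfl⟩

theorem mpow_diag_le (A : Mat n) (k : ℕ) (i : Fin n) : mpow A k i i ≤ mcgm A ^ k := by
  induction k using Nat.strong_induction_on generalizing i with
  | _ k ih =>
    rcases le_or_gt k n with hkn | hkn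
    · exact mpow_diag_le_of_le A hkn i
    obtain ⟨a, b, e, p, habe, hb, hbn, -, hle⟩ :=
      exists_mpow_le_cut (A := A) (t := k) one_pos (by omega) i i
    rw [Nat.mul_one] at hbn
    calc mpow A k i i ≤ mpow A a i p * mpow A b p p * mpow A e p i := hle
      _ = mpow A b p p * (mpow A e p i * mpow A a i p) := by ring
      _ ≤ mcgm A ^ b * mcgm A ^ (e + a) :=
        mul_le_mul' (mpow_diag_le_of_le A hbn p)
          ((mpow_mul_le A e a p i p).trans (ih _ (by omega) p))
      _ = mcgm A ^ k := by rw [← pow_add]; congr 1; omega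

theorem exists_isCycle_cycleMean_eq {A : Mat n} (h : mcgm A ≠ 0) :
    ∃ k c, IsCycle (Edge A) k c ∧ cycleMean A k c = mcgm A := by
  have hne : {x | ∃ k c, k ≤ n ∧ IsCycle (Edge A) k c ∧ x = cycleMean A k c}.Nonempty :=
    Set.nonempty_iff_ne_empty.2 fun he => h (by rw [mcgm, he, csSup_empty, bot_eq_zero])
  obtain ⟨k, c, -, hc, hx⟩ := hne.csSup_mem (finite_cycleMeans A)
  exact ⟨k, c, hc, hx.symm⟩

theorem exists_mpow_diag_eq {A : Mat n} (h : mcgm A ≠ 0) :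
    ∃ k i, 0 < k ∧ mpow A k i i = mcgm A ^ k := by
  obtain ⟨k, c, hc, hx⟩ := exists_isCycle_cycleMean_eq h
  refine ⟨k, c 0, hc.1, le_antisymm (mpow_diag_le A k _) ?_⟩
  rw [← (cycleMean_eq_iff A hc.1 c _).1 hx]
  simpa only [hc.2.1] using weight_le_mpow A k c

theorem mcgm_mono {A B : Mat n} (h : ∀ i j, A i j ≤ B i j) : mcgm A ≤ mcgm B := by
  by_cases h0 : mcgm A = 0
  · exact h0 ▸ zero_le
  obtain ⟨k, i, hk, hki⟩ := exists_mpow_diag_eq h0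
  refine (pow_le_pow_iff_left₀ zero_le zero_le hk.ne').1 ?_
  exact hki ▸ (mpow_mono h k i i).trans (mpow_diag_le B k i)

theorem mpow_eq_zero_of_mcgm_eq_zero {A : Mat n} (h : mcgm A = 0) {t : ℕ} (ht : n ≤ t)
    (i j : Fin n) : mpow A t i j = 0 := by
  obtain ⟨a, b, e, p, -, hb, -, -, hle⟩ :=
    exists_mpow_le_cut (A := A) (t := t) one_pos (by omega) i j
  have hp : mpow A b p p = 0 := by simpa [h, hb.ne'] using mpow_diag_le A b p
  simpa [hp] using hle

-- Closed walks of mean at most `ρ` and of length divisible by `d` are cut out repeatedly.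
theorem exists_short_walk {A : Mat n} {ρ : ℝ≥0} (hA : mcgm A ≤ ρ) (hρ : ρ ≠ 0) {d : ℕ}
    (hd : 0 < d) (t : ℕ) (i j : Fin n) :
    ∃ u ≤ n * d, u ≡ t [MOD d] ∧ mpow A t i j / ρ ^ t ≤ mpow A u i j / ρ ^ u := by
  induction t using Nat.strong_induction_on with
  | _ t ih =>
    rcases le_or_gt t (n * d) with ht | ht
    · exact ⟨t, ht, rfl, le_rfl⟩
    obtain ⟨a, b, e, p, habe, hb, -, hdb, hle⟩ := exists_mpow_le_cut (A := A) hd ht.le i j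
    obtain ⟨u, hu, hmod, hle'⟩ := ih (a + e) (by omega)
    have hp : mpow A b p p / ρ ^ b ≤ 1 :=
      div_le_one_of_le₀ ((mpow_diag_le A b p).trans (pow_le_pow_left₀ zero_le hA b)) zero_le
    refine ⟨u, hu, hmod.trans ?_, ?_⟩
    · rw [← habe, Nat.add_right_comm]
      exact Nat.left_modEq_add_iff.2 hdb
    · calc mpow A t i j / ρ ^ t
          ≤ mpow A a i p * mpow A b p p * mpow A e p j / ρ ^ t := by gcongr
        _ = mpow A b p p / ρ ^ b * (mpow A a i p * mpow A e p j / ρ ^ (a + e)) := by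
          rw [← habe]; field_simp; ring
        _ ≤ 1 * (mpow A (a + e) i j / ρ ^ (a + e)) := by
          gcongr
          exact mpow_mul_le A a e i p j
        _ ≤ mpow A u i j / ρ ^ u := by rwa [one_mul]

theorem exists_mpow_le {A : Mat n} {ρ : ℝ≥0} (hA : mcgm A ≤ ρ) (hρ : ρ ≠ 0) :
    ∃ C : ℝ≥0, ∀ t i j, mpow A t i j ≤ C * ρ ^ t := by
  obtain ⟨C, hC⟩ := (Set.finite_range fun q : Fin (n * 1 + 1) × Fin n × Fin n =>
    mpow A q.1 q.2.1 q.2.2 / ρ ^ (q.1 : ℕ)).bddAbove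
  refine ⟨C, fun t i j => ?_⟩
  obtain ⟨u, hu, -, hle⟩ := exists_short_walk hA hρ one_pos t i j
  rw [← div_le_iff₀ (pow_pos (pos_iff_ne_zero.2 hρ) t)]
  exact hle.trans (hC ⟨(⟨u, by omega⟩, i, j), rfl⟩)

/-! Cycles and closed walks -/

theorem SameComp.trans {E : Fin n → Fin n → Prop} {i j k : Fin n} (h : SameComp E i j)
    (h' : SameComp E j k) : SameComp E i k :=
  ⟨Relation.ReflTransGen.trans h.1 h'.1, Relation.ReflTransGen.trans h'.2 h.2⟩

theorem IsCycle.access {E : Fin n → Fin n → Prop} {k : ℕ} {c : ℕ → Fin n} (hc : IsCycle E k c)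
    {s t : ℕ} (hst : s ≤ t) (ht : t ≤ k) : Access E (c s) (c t) := by
  induction t, hst using Nat.le_induction with
  | base => exact Relation.ReflTransGen.refl
  | succ t _ ih => exact (ih (by omega)).tail (hc.2.2 t (by omega))

theorem IsCycle.sameComp {E : Fin n → Fin n → Prop} {k : ℕ} {c : ℕ → Fin n} (hc : IsCycle E k c)
    {t : ℕ} (ht : t ≤ k) : SameComp E (c t) (c 0) :=
  ⟨hc.2.1 ▸ hc.access ht le_rfl, hc.access (Nat.zero_le t) ht⟩

theorem IsCycle.exists_isSimpleCycle {E : Fin n → Fin n → Prop} {k : ℕ} {c : ℕ → Fin n}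
    (hc : IsCycle E k c) : ∃ l c', IsSimpleCycle E l c' ∧ SameComp E (c' 0) (c 0) := by
  induction k using Nat.strong_induction_on generalizing c with
  | _ k ih =>
    by_cases hinj : Set.InjOn c (Set.Iio k)
    · exact ⟨k, c, ⟨hc, hinj⟩, hc.sameComp (Nat.zero_le k)⟩
    obtain ⟨a, b, hab, hb, heq⟩ : ∃ a b, a < b ∧ b < k ∧ c a = c b := by
      simp only [Set.InjOn, Set.mem_Iio, not_forall] at hinj
      obtain ⟨a, ha, b, hb, heq, hne⟩ := hinj
      rcases lt_or_gt_of_ne hne with h | h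
      exacts [⟨a, b, h, hb, heq⟩, ⟨b, a, h, ha, heq.symm⟩]
    have hcycle : IsCycle E (b - a) fun s => c (a + s) :=
      ⟨by omega, by simp only [Nat.add_sub_of_le hab.le, Nat.add_zero, heq],
        fun t ht => hc.2.2 (a + t) (by omega)⟩
    obtain ⟨l, c', hc', hcomp⟩ := ih (b - a) (by omega) hcycle
    exact ⟨l, c', hc', hcomp.trans (hc.sameComp (by omega))⟩

theorem IsSimpleCycle.length_le {E : Fin n → Fin n → Prop} {k : ℕ} {c : ℕ → Fin n}
    (hc : IsSimpleCycle E k c) : k ≤ n := by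
  simpa using Finset.card_le_card_of_injOn (s := Finset.range k) (t := Finset.univ) c
    (fun _ _ => Finset.mem_univ _) (by simpa using hc.2)

theorem compCyclicity_ne_zero {E : Fin n → Fin n → Prop} {i : Fin n} {k : ℕ} {c : ℕ → Fin n}
    (hc : IsCycle E k c) (hi : SameComp E (c 0) i) : compCyclicity E i ≠ 0 := by
  classical
  obtain ⟨l, c', hc', hcomp⟩ := hc.exists_isSimpleCycle
  have hl : l ∈ (Finset.Icc 1 n).filter
      fun k => ∃ c, IsSimpleCycle E k c ∧ SameComp E (c 0) i :=
    Finset.mem_filter.2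
      ⟨Finset.mem_Icc.2 ⟨hc'.1.1, hc'.length_le⟩, c', hc', hcomp.trans hi⟩
  exact fun h0 => hc'.1.1.ne' (Finset.gcd_eq_zero_iff.1 h0 l hl)

/-- The lengths of the closed walks through `i` in the digraph of `A`. -/
def loopLengths (A : Mat n) (i : Fin n) : AddSubmonoid ℕ where
  carrier := {l | mpow A l i i ≠ 0}
  zero_mem' := by simp
  add_mem' ha hb := mpow_add_ne_zero ha hb

-- Traversing a simple cycle of the component of `i` lengthens a closed walk through `i` by the
-- length of the cycle.
theorem setGcd_loopLengths_dvd (A : Mat n) (i : Fin n) :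
    Nat.setGcd (loopLengths A i : Set ℕ) ∣ compCyclicity (Edge A) i := by
  classical
  refine Finset.dvd_gcd fun s hs => ?_
  obtain ⟨-, c, ⟨hc, -⟩, hcomp⟩ := Finset.mem_filter.1 hs
  rw [SameComp, access_iff, access_iff] at hcomp
  obtain ⟨⟨p, hp⟩, ⟨q, hq⟩⟩ := hcomp
  have hs : mpow A s (c 0) (c 0) ≠ 0 := by
    have := weight_le_mpow A s c
    rw [hc.2.1] at this
    exact ne_bot_of_le_ne_bot (weight_ne_zero_iff.2 hc.2.2) this
  have hqp : q + p ∈ loopLengths A i := mpow_add_ne_zero hq hp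
  have hqsp : q + p + s ∈ loopLengths A i := by
    rw [Nat.add_right_comm]
    exact mpow_add_ne_zero (mpow_add_ne_zero hq hs) hp
  exact (Nat.dvd_add_right (Nat.setGcd_dvd_of_mem hqp)).1 (Nat.setGcd_dvd_of_mem hqsp)

theorem exists_forall_ge_mpow_ne_zero (A : Mat n) (i : Fin n) :
    ∃ l₀, ∀ m ≥ l₀, compCyclicity (Edge A) i ∣ m → mpow A m i i ≠ 0 := by
  obtain ⟨l₀, hl₀⟩ := Nat.exists_mem_closure_of_ge (loopLengths A i : Set ℕ)
  refine ⟨l₀, fun m hm hdvd => ?_⟩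
  have := hl₀ m hm ((setGcd_loopLengths_dvd A i).trans hdvd)
  rwa [AddSubmonoid.closure_eq] at this

/-! The critical digraph -/

/-- The entries of `A` on the critical edges, zero elsewhere. -/
noncomputable def crit (A : Mat n) : Mat n := csrS A (CritEdge A)

theorem CritEdge.ne_zero {A : Mat n} {i j : Fin n} (h : CritEdge A i j) : A i j ≠ 0 := by
  obtain ⟨k, c, hc, -, t, ht, rfl, rfl⟩ := h
  exact hc.2.2 t ht

theorem edge_crit (A : Mat n) : Edge (crit A) = CritEdge A := by
  ext i j
  unfold Edge crit csrS
  split_ifs with h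
  · simp [h, h.ne_zero]
  · simp [h]

theorem crit_le (A : Mat n) (i j : Fin n) : crit A i j ≤ A i j := by
  unfold crit csrS
  split_ifs <;> simp

theorem IsCycle.critEdge {A : Mat n} {k : ℕ} {c : ℕ → Fin n} (hc : IsCycle (Edge A) k c)
    (hm : cycleMean A k c = mcgm A) : IsCycle (CritEdge A) k c :=
  ⟨hc.1, hc.2.1, fun t ht => ⟨k, c, hc, hm, t, ht, rfl, rfl⟩⟩

theorem exists_isCycle_of_isNode {A : Mat n} {i : Fin n} (h : IsNode (CritEdge A) i) :
    ∃ k c, IsCycle (Edge A) k c ∧ cycleMean A k c = mcgm A ∧ ∃ t ≤ k, c t = i := by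
  obtain ⟨j, ⟨k, c, hc, hm, t, ht, rfl, -⟩ | ⟨k, c, hc, hm, t, ht, -, rfl⟩⟩ := h
  exacts [⟨k, c, hc, hm, t, ht.le, rfl⟩, ⟨k, c, hc, hm, t + 1, ht, rfl⟩]

theorem mcgm_ne_zero_of_isNode {A : Mat n} {i : Fin n} (h : IsNode (CritEdge A) i) :
    mcgm A ≠ 0 := by
  obtain ⟨k, c, hc, hm, -⟩ := exists_isCycle_of_isNode h
  have hw := weight_ne_zero_iff.2 hc.2.2
  rw [(cycleMean_eq_iff A hc.1 c _).1 hm] at hw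
  exact (pow_ne_zero_iff hc.1.ne').1 hw

theorem isNode_critEdge_of_mpow_diag {A : Mat n} (h : mcgm A ≠ 0) {k : ℕ} (hk : 0 < k) {i : Fin n}
    (hki : mpow A k i i = mcgm A ^ k) : IsNode (CritEdge A) i := by
  obtain ⟨c, rfl, hc, hw⟩ := exists_isCycle_weight_eq hk (hki ▸ pow_ne_zero k h)
  have hm := (cycleMean_eq_iff A hk c _).2 (hw.trans hki)
  exact ⟨c 1, Or.inl ((hc.critEdge hm).2.2 0 hk)⟩

theorem exists_isNode_critEdge {A : Mat n} (h : mcgm A ≠ 0) : ∃ i, IsNode (CritEdge A) i := by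
  obtain ⟨k, i, hk, hki⟩ := exists_mpow_diag_eq h
  exact ⟨i, isNode_critEdge_of_mpow_diag h hk hki⟩

theorem cyclicity_critEdge_pos (A : Mat n) : 0 < cyclicity (CritEdge A) := by
  rw [Nat.pos_iff_ne_zero, cyclicity, Ne, Finset.lcm_eq_zero_iff]
  rintro ⟨i, hi, h0⟩
  obtain ⟨k, c, hc, hm, t, ht, rfl⟩ := exists_isCycle_of_isNode (by simpa using hi)
  have hcomp := (hc.critEdge hm).sameComp ht
  exact compCyclicity_ne_zero (hc.critEdge hm) ⟨hcomp.2, hcomp.1⟩ h0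

theorem exists_crit_loops {A : Mat n} {i : Fin n} (h : IsNode (CritEdge A) i) :
    ∃ l₀, ∀ m ≥ l₀, cyclicity (CritEdge A) ∣ m → mpow (crit A) m i i ≠ 0 := by
  obtain ⟨l₀, hl₀⟩ := exists_forall_ge_mpow_ne_zero (crit A) i
  refine ⟨l₀, fun m hm hdvd => hl₀ m hm (dvd_trans ?_ hdvd)⟩
  rw [edge_crit]
  exact Finset.dvd_lcm (f := fun i => compCyclicity (CritEdge A) i) (by simpa using h)

theorem exists_crit_detour {A : Mat n} {k : Fin n} (hk : IsNode (CritEdge A) k) {d : ℕ}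
    (hd : 0 < d) (hcyc : cyclicity (CritEdge A) ∣ d) (s : ℕ) :
    ∃ q l, mpow (crit A) s k q ≠ 0 ∧ mpow (crit A) l q k ≠ 0 ∧ d ∣ s + l := by
  obtain ⟨l₀, hl₀⟩ := exists_crit_loops hk
  obtain ⟨l, hl⟩ := Nat.exists_eq_add_of_le (show s ≤ d * (l₀ + s) by nlinarith)
  have hloop := hl₀ (d * (l₀ + s)) (by nlinarith) (hcyc.mul_right _)
  rw [hl, mpow_add_ne_zero_iff] at hloop
  obtain ⟨q, hq₁, hq₂⟩ := hloop
  exact ⟨q, l, hq₁, hq₂, hl ▸ dvd_mul_right _ _⟩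

theorem CritEdge.exists_return {A : Mat n} {i j : Fin n} (h : CritEdge A i j) :
    ∃ l, mcgm A ^ (l + 1) ≤ A i j * mpow A l j i := by
  obtain ⟨k, c, hc, hm, t, ht, rfl, rfl⟩ := h
  obtain ⟨e, rfl⟩ := Nat.exists_eq_add_of_le (Nat.succ_le_of_lt ht)
  have hw := (cycleMean_eq_iff A hc.1 c _).1 hm
  have hhead := weight_le_mpow A t c
  have htail := weight_le_mpow A e fun s => c (t + 1 + s)
  rw [hc.2.1, Nat.add_zero] at htail
  refine ⟨e + t, ?_⟩
  calc mcgm A ^ (e + t + 1) = weight A (t + 1 + e) c := by rw [hw]; congr 1; omega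
    _ = weight A t c * A (c t) (c (t + 1)) * weight A e (fun s => c (t + 1 + s)) := by
      rw [weight_add, weight_succ]
    _ ≤ mpow A t (c 0) (c t) * A (c t) (c (t + 1)) * mpow A e (c (t + 1)) (c 0) := by gcongr
    _ = A (c t) (c (t + 1)) * (mpow A e (c (t + 1)) (c 0) * mpow A t (c 0) (c t)) := by ring
    _ ≤ _ := mul_le_mul_right (mpow_mul_le _ _ _ _ _ _) _

theorem exists_return_crit {A : Mat n} {l : ℕ} {i j : Fin n} (hl : mpow (crit A) l i j ≠ 0) :
    ∃ l', mcgm A ^ (l + l') ≤ mpow A l i j * mpow A l' j i := by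
  induction l generalizing j with
  | zero =>
    obtain rfl := eq_of_mpow_zero_ne_zero hl
    exact ⟨0, by simp⟩
  | succ l ih =>
    obtain ⟨k, h₁, h₂⟩ := mmul_ne_zero_iff.1 hl
    obtain ⟨l₁, hl₁⟩ := ih h₁
    obtain ⟨l₂, hl₂⟩ := CritEdge.exists_return (edge_crit A ▸ h₂ : CritEdge A k j)
    refine ⟨l₂ + l₁, ?_⟩
    calc mcgm A ^ (l + 1 + (l₂ + l₁)) = mcgm A ^ (l + l₁) * mcgm A ^ (l₂ + 1) := by ring
      _ ≤ mpow A l i k * mpow A l₁ k i * (A k j * mpow A l₂ j k) := mul_le_mul' hl₁ hl₂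
      _ = mpow A l i k * A k j * (mpow A l₂ j k * mpow A l₁ k i) := by ring
      _ ≤ _ := mul_le_mul' (mul_le_mmul _ _ _ _ _) (mpow_mul_le _ _ _ _ _ _)

theorem pow_le_mpow_diag {A : Mat n} (h : mcgm A ≠ 0) {l : ℕ} {i : Fin n}
    (hl : mpow (crit A) l i i ≠ 0) : mcgm A ^ l ≤ mpow A l i i := by
  obtain ⟨l', hl'⟩ := exists_return_crit hl
  refine le_of_mul_le_mul_right ?_ (pow_pos (pos_iff_ne_zero.2 h) l')
  calc mcgm A ^ l * mcgm A ^ l' ≤ mpow A l i i * mpow A l' i i := by rwa [← pow_add]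
    _ ≤ mpow A l i i * mcgm A ^ l' := mul_le_mul_right (mpow_diag_le A l' i) _

/-! Walks through a set of nodes -/

/-- There is a walk from `i` to `j` through a node of `N` whose length is congruent to `r` modulo
`d`; it is split at a node of `N` into walks of lengths `a` and `b`. -/
def WalkThrough (A : Mat n) (N : Fin n → Prop) (d r : ℕ) (i j : Fin n) : Prop :=
  ∃ k a b, N k ∧ mpow A a i k ≠ 0 ∧ mpow A b k j ≠ 0 ∧ a + b ≡ r [MOD d]

theorem WalkThrough.of_dvd {A : Mat n} {N : Fin n → Prop} {g d r : ℕ} {i j : Fin n}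
    (h : WalkThrough A N d r i j) (hg : g ∣ d) : WalkThrough A N g r i j := by
  obtain ⟨k, a, b, hk, ha, hb, hab⟩ := h
  exact ⟨k, a, b, hk, ha, hb, hab.of_dvd hg⟩

theorem WalkThrough.congr {A : Mat n} {N : Fin n → Prop} {d r r' : ℕ} {i j : Fin n}
    (h : WalkThrough A N d r i j) (hr : r ≡ r' [MOD d]) : WalkThrough A N d r' i j := by
  obtain ⟨k, a, b, hk, ha, hb, hab⟩ := h
  exact ⟨k, a, b, hk, ha, hb, hab.trans hr⟩

theorem WalkThrough.prepend {A : Mat n} {N : Fin n → Prop} {d r s : ℕ} {i j p : Fin n}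
    (h : WalkThrough A N d r i j) (hs : mpow A s p i ≠ 0) : WalkThrough A N d (s + r) p j := by
  obtain ⟨k, a, b, hk, ha, hb, hab⟩ := h
  exact ⟨k, s + a, b, hk, mpow_add_ne_zero hs ha, hb,
    by simpa only [Nat.add_assoc] using hab.add_left s⟩

-- Closed critical walks of all large lengths divisible by the cyclicity can be inserted.
theorem WalkThrough.of_cyclicity {A : Mat n} {d r : ℕ} {i j : Fin n}
    (h : WalkThrough A (IsNode (CritEdge A)) (cyclicity (CritEdge A)) r i j) (hd : 0 < d)
    (hcyc : cyclicity (CritEdge A) ∣ d) : WalkThrough A (IsNode (CritEdge A)) d r i j := by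
  obtain ⟨k, a, b, hk, ha, hb, hab⟩ := h
  obtain ⟨l₀, hl₀⟩ := exists_crit_loops hk
  obtain ⟨m, hm⟩ := Nat.exists_eq_add_of_le (show a + b ≤ r + d * (a + b + l₀) by nlinarith)
  have hml : l₀ ≤ m := by nlinarith
  have hmd : cyclicity (CritEdge A) ∣ m := by
    refine Nat.left_modEq_add_iff.1 (hab.trans ?_)
    rw [← hm]
    exact Nat.left_modEq_add_iff.2 (hcyc.mul_right _)
  have hloop : mpow A m k k ≠ 0 := mpow_ne_zero_of_le (crit_le A) (hl₀ m hml hmd)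
  refine ⟨k, a, m + b, hk, ha, mpow_add_ne_zero hloop hb, ?_⟩
  rw [← Nat.add_assoc, Nat.add_right_comm, ← hm]
  exact Nat.ModEq.symm (Nat.left_modEq_add_iff.2 (dvd_mul_right _ _))

/-! Restrictions -/

theorem restrict_le (A : Mat n) (K : Set (Fin n)) (i j : Fin n) : restrict A K i j ≤ A i j := by
  unfold restrict
  split_ifs <;> simp

theorem restrict_ne_zero {A : Mat n} {K : Set (Fin n)} {i j : Fin n}
    (h : restrict A K i j ≠ 0) : i ∈ K ∧ j ∈ K :=
  not_imp_comm.1 (fun h' => if_neg h') h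

theorem mpow_le_restrict_or (A : Mat n) (K : Set (Fin n)) (t : ℕ) (i j : Fin n) :
    mpow A t i j ≤ mpow (restrict A K) t i j ∨
      ∃ k ∉ K, ∃ a b, a + b = t ∧ mpow A t i j ≤ mpow A a i k * mpow A b k j := by
  induction t generalizing j with
  | zero => exact Or.inl le_rfl
  | succ t ih =>
    obtain ⟨l, hl⟩ : ∃ l, mpow A (t + 1) i j = mpow A t i l * A l j := exists_mmul_eq _ _ _ _
    rw [hl]
    rcases ih l with h | ⟨k, hk, a, b, rfl, h⟩
    · by_cases hlK : l ∈ K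
      · by_cases hjK : j ∈ K
        · have hr : restrict A K l j = A l j := if_pos ⟨hlK, hjK⟩
          exact Or.inl ((mul_le_mul' h hr.ge).trans (mul_le_mmul _ _ i l j))
        · exact Or.inr ⟨j, hjK, t + 1, 0, rfl, by simpa using hl.ge⟩
      · exact Or.inr ⟨l, hlK, t, 1, rfl, by simp⟩
    · refine Or.inr ⟨k, hk, a, b + 1, rfl, (mul_le_mul_left h _).trans ?_⟩
      rw [mul_assoc]
      exact mul_le_mul_right (mul_le_mmul _ _ k l j) _

theorem mpow_restrict_eq {A : Mat n} {K : Set (Fin n)} {t : ℕ} {i j : Fin n}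
    (h : ∀ a b k, a + b = t → mpow A a i k ≠ 0 → mpow A b k j ≠ 0 → k ∈ K) :
    mpow (restrict A K) t i j = mpow A t i j := by
  refine le_antisymm (mpow_mono (restrict_le A K) t i j) ?_
  rcases mpow_le_restrict_or A K t i j with hle | ⟨k, hk, a, b, hab, hle⟩
  · exact hle
  have h0 : mpow A a i k * mpow A b k j = 0 :=
    not_not.1 fun h' => hk (h a b k hab (left_ne_zero_of_mul h') (right_ne_zero_of_mul h'))
  exact hle.trans (h0 ▸ zero_le)

theorem mcgm_restrict_lt {A : Mat n} (h : mcgm A ≠ 0) {K : Set (Fin n)}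
    (hK : ∀ i ∈ K, ¬ IsNode (CritEdge A) i) : mcgm (restrict A K) < mcgm A := by
  refine lt_of_le_of_ne (mcgm_mono (restrict_le A K)) fun heq => ?_
  obtain ⟨k, i, hk, hki⟩ := exists_mpow_diag_eq (heq.trans_ne h)
  rw [heq] at hki
  obtain ⟨c, rfl, hc, -⟩ := exists_isCycle_weight_eq hk (hki ▸ pow_ne_zero k h)
  refine hK (c 0) (restrict_ne_zero (hc.2.2 0 hk)).1
    (isNode_critEdge_of_mpow_diag h hk (le_antisymm (mpow_diag_le A k _) ?_))
  exact hki ▸ mpow_mono (restrict_le A K) k _ _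

/-! Powers in a residue class modulo a multiple of the cyclicity of the critical digraph -/

/-- The normalized weights of the walks considered in `WalkThrough`. -/
def walkWeights (A : Mat n) (ρ : ℝ≥0) (N : Fin n → Prop) (d r : ℕ) (i j : Fin n) : Set ℝ≥0 :=
  {x | ∃ k a b, N k ∧ a + b ≡ r [MOD d] ∧ x = mpow A a i k * mpow A b k j / ρ ^ (a + b)}

theorem exists_isGreatest_walkWeights {A : Mat n} {ρ : ℝ≥0} (hA : mcgm A ≤ ρ) (hρ : ρ ≠ 0)
    {N : Fin n → Prop} {d r : ℕ} (hd : 0 < d) {i j : Fin n} (h : WalkThrough A N d r i j) :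
    ∃ F ≠ 0, IsGreatest (walkWeights A ρ N d r i j) F := by
  let f : Fin n × ℕ × ℕ → ℝ≥0 := fun q =>
    mpow A q.2.1 i q.1 * mpow A q.2.2 q.1 j / ρ ^ (q.2.1 + q.2.2)
  let Q : Set (Fin n × ℕ × ℕ) :=
    {q | N q.1 ∧ q.2.1 ≤ n * d ∧ q.2.2 ≤ n * d ∧ q.2.1 + q.2.2 ≡ r [MOD d]}
  have hshort : ∀ k a b, N k → a + b ≡ r [MOD d] → ∃ q ∈ Q, f (k, a, b) ≤ f q := by
    intro k a b hk hab
    obtain ⟨u, hu, hua, hle⟩ := exists_short_walk hA hρ hd a i k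
    obtain ⟨v, hv, hvb, hle'⟩ := exists_short_walk hA hρ hd b k j
    refine ⟨(k, u, v), ⟨hk, hu, hv, (hua.add hvb).trans hab⟩, ?_⟩
    simp only [f, pow_add, mul_div_mul_comm]
    exact mul_le_mul' hle hle'
  obtain ⟨k, a, b, hk, ha, hb, hab⟩ := h
  have hQ : Q.Finite :=
    (Set.finite_univ.prod ((Set.finite_Iic (n * d)).prod (Set.finite_Iic (n * d)))).subset
      fun q hq => ⟨Set.mem_univ _, hq.2.1, hq.2.2.1⟩
  obtain ⟨q₀, hq₀, hle₀⟩ := hshort k a b hk hab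
  obtain ⟨q, hq, hmax⟩ := Set.exists_max_image Q f hQ ⟨q₀, hq₀⟩
  refine ⟨f q, ?_, ⟨q.1, q.2.1, q.2.2, hq.1, hq.2.2.2, rfl⟩, ?_⟩
  · refine ne_bot_of_le_ne_bot ?_ (hle₀.trans (hmax q₀ hq₀))
    exact div_ne_zero (mul_ne_zero ha hb) (pow_ne_zero _ hρ)
  · rintro _ ⟨k, a, b, hk, hab, rfl⟩
    obtain ⟨q', hq', hle'⟩ := hshort k a b hk hab
    exact hle'.trans (hmax q' hq')

theorem eventually_mpow_le {A : Mat n} (h : mcgm A ≠ 0) {d r : ℕ} {i j : Fin n} {F : ℝ≥0}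
    (hF : F ≠ 0)
    (hle : F ∈ upperBounds (walkWeights A (mcgm A) (IsNode (CritEdge A)) d r i j)) :
    ∀ᶠ t in atTopMod r d, mpow A t i j ≤ F * mcgm A ^ t := by
  obtain ⟨ρ, hρ₁, hρ₂⟩ :=
    exists_between (mcgm_restrict_lt (K := {i | ¬ IsNode (CritEdge A) i}) h fun i hi => hi)
  obtain ⟨C, hC⟩ := exists_mpow_le hρ₁.le (lt_of_le_of_lt zero_le hρ₁).ne'
  rw [eventually_atTopMod]
  filter_upwards [eventually_mul_pow_le C hρ₂ hF] with t ht hmod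
  rcases mpow_le_restrict_or A {i | ¬ IsNode (CritEdge A) i} t i j with
    hres | ⟨k, hk, a, b, rfl, hres⟩
  · exact hres.trans ((hC t i j).trans ht)
  · refine hres.trans ((div_le_iff₀ (pow_pos (pos_iff_ne_zero.2 h) _)).1 ?_)
    exact hle ⟨k, a, b, not_not.1 hk, hmod, rfl⟩

theorem eventually_le_mpow {A : Mat n} {d : ℕ} (hcyc : cyclicity (CritEdge A) ∣ d) {r : ℕ}
    {i j : Fin n} {F : ℝ≥0}
    (hF : F ∈ walkWeights A (mcgm A) (IsNode (CritEdge A)) d r i j) :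
    ∀ᶠ t in atTopMod r d, F * mcgm A ^ t ≤ mpow A t i j := by
  obtain ⟨k, a, b, hk, hab, rfl⟩ := hF
  have h := mcgm_ne_zero_of_isNode hk
  obtain ⟨l₀, hl₀⟩ := exists_crit_loops hk
  rw [eventually_atTopMod]
  filter_upwards [Filter.eventually_ge_atTop (a + b + l₀)] with t ht hmod
  obtain ⟨m, rfl⟩ := Nat.exists_eq_add_of_le (show a + b ≤ t by omega)
  have hdm : d ∣ m := Nat.left_modEq_add_iff.1 (hab.trans hmod.symm)
  have hm : mcgm A ^ m ≤ mpow A m k k :=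
    pow_le_mpow_diag h (hl₀ m (by omega) (hcyc.trans hdm))
  calc mpow A a i k * mpow A b k j / mcgm A ^ (a + b) * mcgm A ^ (a + b + m)
      = mpow A a i k * mcgm A ^ m * mpow A b k j := by rw [pow_add _ (a + b)]; field_simp
    _ ≤ mpow A a i k * mpow A m k k * mpow A b k j := by gcongr
    _ ≤ mpow A (a + m + b) i j :=
      (mul_le_mul_left (mpow_mul_le _ _ _ _ _ _) _).trans (mpow_mul_le _ _ _ _ _ _)
    _ = mpow A (a + b + m) i j := by rw [Nat.add_right_comm]

theorem WalkThrough.eventuallyGeometric {A : Mat n} {d r : ℕ} {i j : Fin n}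
    (h : WalkThrough A (IsNode (CritEdge A)) d r i j) (hd : 0 < d)
    (hcyc : cyclicity (CritEdge A) ∣ d) :
    EventuallyGeometric (atTopMod r d) (fun t => mpow A t i j) (mcgm A) := by
  have hA : mcgm A ≠ 0 := mcgm_ne_zero_of_isNode h.choose_spec.choose_spec.choose_spec.1
  obtain ⟨F, hF, hmem, hle⟩ := exists_isGreatest_walkWeights le_rfl hA hd h
  refine ⟨F, hF, ?_⟩
  filter_upwards [eventually_mpow_le hA hF hle, eventually_le_mpow hcyc hmem] with t h₁ h₂
  exact le_antisymm h₁ h₂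

/-! The support of the products `C ⊗ S ⊗ R` -/

theorem mpow_scale (A : Mat n) (l : ℝ≥0) (t : ℕ) (i j : Fin n) :
    mpow (scale A l) t i j = mpow A t i j / l ^ t := by
  induction t generalizing j with
  | zero => simp [mpow]
  | succ t ih =>
    simp only [mpow, mmul, NNReal.finset_sup_div]
    refine Finset.sup_congr rfl fun k _ => ?_
    rw [ih, scale, pow_succ, div_mul_div_comm]

theorem csrB_ne_zero_iff {A : Mat n} (h : mcgm A ≠ 0) (E : Fin n → Fin n → Prop) (i j : Fin n) :
    csrB (scale A (mcgm A)) E i j ≠ 0 ↔ ∃ s, mpow A (cyclicity E * s) i j ≠ 0 := by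
  obtain ⟨C, hC⟩ := exists_mpow_le (A := A) le_rfl h
  have hpos : ∀ t, 0 < mcgm A ^ t := fun t => pow_pos (pos_iff_ne_zero.2 h) t
  have hbdd : BddAbove (Set.range fun s =>
      mpow A (cyclicity E * s) i j / mcgm A ^ (cyclicity E * s)) :=
    ⟨C, Set.forall_mem_range.2 fun s => (div_le_iff₀ (hpos _)).2 (hC _ i j)⟩
  simp only [csrB, star, mpow_mpow, mpow_scale]
  constructor
  · contrapose!
    intro h0
    simp [h0]
  · rintro ⟨s, hs⟩
    exact ne_bot_of_le_ne_bot (div_ne_zero hs (hpos _).ne') (le_ciSup hbdd s)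

theorem csr_ne_zero_iff {A : Mat n} (h : mcgm A ≠ 0) (i j : Fin n) :
    csr (scale A (mcgm A)) (CritEdge A) 1 i j ≠ 0 ↔
      ∃ k k' s s', CritEdge A k k' ∧ mpow A (cyclicity (CritEdge A) * s) i k ≠ 0 ∧
        mpow A (cyclicity (CritEdge A) * s') k' j ≠ 0 := by
  have hS : ∀ k k', csrS (scale A (mcgm A)) (CritEdge A) k k' ≠ 0 ↔ CritEdge A k k' := by
    intro k k'
    by_cases hE : CritEdge A k k'
    · simp [csrS, hE, scale, h, hE.ne_zero]
    · simp [csrS, hE]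
  have hC : ∀ k, csrC (scale A (mcgm A)) (CritEdge A) i k ≠ 0 ↔
      IsNode (CritEdge A) k ∧ ∃ s, mpow A (cyclicity (CritEdge A) * s) i k ≠ 0 := by
    intro k
    simp only [csrC, ne_eq, ite_eq_right_iff, Classical.not_imp, ← csrB_ne_zero_iff h]
  have hR : ∀ k, csrR (scale A (mcgm A)) (CritEdge A) k j ≠ 0 ↔
      IsNode (CritEdge A) k ∧ ∃ s, mpow A (cyclicity (CritEdge A) * s) k j ≠ 0 := by
    intro k
    simp only [csrR, ne_eq, ite_eq_right_iff, Classical.not_imp, ← csrB_ne_zero_iff h]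
  simp only [csr, mmul_ne_zero_iff, mpow_one, hS, hC, hR]
  constructor
  · rintro ⟨k', ⟨k, ⟨-, s, hs⟩, hE⟩, -, s', hs'⟩
    exact ⟨k, k', s, s', hE, hs, hs'⟩
  · rintro ⟨k, k', s, s', hE, hs, hs'⟩
    exact ⟨k', ⟨k, ⟨⟨k', Or.inl hE⟩, s, hs⟩, hE⟩, ⟨k, Or.inr hE⟩, s', hs'⟩

-- A walk through a critical node is moved along critical walks so that the numbers of its edges
-- before and after a critical edge become multiples of the cyclicity.
theorem csr_one_ne_zero_iff_walkThrough {A : Mat n} (h : mcgm A ≠ 0) (i j : Fin n) :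
    csr (scale A (mcgm A)) (CritEdge A) 1 i j ≠ 0 ↔
      WalkThrough A (IsNode (CritEdge A)) (cyclicity (CritEdge A)) 1 i j := by
  rw [csr_ne_zero_iff h]
  set g := cyclicity (CritEdge A)
  have hg : 0 < g := cyclicity_critEdge_pos A
  constructor
  · rintro ⟨k, k', s, s', hE, hs, hs'⟩
    refine ⟨k, g * s, 1 + g * s', ⟨k', Or.inl hE⟩, hs,
      mpow_add_ne_zero (by rw [mpow_one]; exact hE.ne_zero) hs', ?_⟩
    rw [show g * s + (1 + g * s') = 1 + g * (s + s') by ring]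
    exact (Nat.left_modEq_add_iff.2 (dvd_mul_right _ _)).symm
  · rintro ⟨k, a, b, hk, ha, hb, hab⟩
    obtain ⟨c, hc⟩ := Nat.exists_eq_add_of_le (show a ≤ g * a by nlinarith)
    obtain ⟨q, l, hq, hl, hdvd⟩ := exists_crit_detour hk hg dvd_rfl (c + 1)
    obtain ⟨p, hp, hpq⟩ := mpow_add_ne_zero_iff.1 hq
    have hhead : mpow A (g * a) i p ≠ 0 :=
      hc ▸ mpow_add_ne_zero ha (mpow_ne_zero_of_le (crit_le A) hp)
    have htail : mpow A (l + b) q j ≠ 0 :=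
      mpow_add_ne_zero (mpow_ne_zero_of_le (crit_le A) hl) hb
    have hlb : g ∣ l + b := by
      rw [← Nat.modEq_zero_iff_dvd]
      refine Nat.ModEq.add_right_cancel' (a + c + 1) ?_
      calc l + b + (a + c + 1) = (a + b) + (c + 1 + l) := by ring
        _ ≡ 1 + 0 [MOD g] := hab.add ((Nat.modEq_zero_iff_dvd).2 hdvd)
        _ ≡ 1 + g * a [MOD g] := Nat.left_modEq_add_iff.2 (dvd_mul_right _ _)
        _ = 0 + (a + c + 1) := by rw [hc]; ring
    obtain ⟨s', hs'⟩ := hlb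
    rw [mpow_one] at hpq
    exact ⟨p, q, a, s', edge_crit A ▸ hpq, hhead, hs' ▸ htail⟩

/-! The terms of the ultimate expansion -/

theorem ultK_succ_subset (A : Mat n) (μ : ℕ) : ultK A (μ + 1) ⊆ ultK A μ := Set.sdiff_subset

theorem mem_ultK_of_isNode {A : Mat n} {μ : ℕ} {i : Fin n} (h : IsNode (CritEdge (ultA A μ)) i) :
    i ∈ ultK A μ := by
  obtain ⟨j, h | h⟩ := h
  · exact (restrict_ne_zero h.ne_zero).1
  · exact (restrict_ne_zero h.ne_zero).2

theorem notMem_ultK_succ_of_isNode {A : Mat n} {μ : ℕ} {i : Fin n}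
    (h : IsNode (CritEdge (ultA A μ)) i) : i ∉ ultK A (μ + 1) := fun hi =>
  hi.2 ⟨i, h, Relation.ReflTransGen.refl, Relation.ReflTransGen.refl⟩

theorem exists_isNode_of_notMem_ultK {A : Mat n} {ν : ℕ} {p : Fin n} (h : p ∉ ultK A ν) :
    ∃ μ < ν, ∃ k, IsNode (CritEdge (ultA A μ)) k ∧ SameComp (Edge A) p k := by
  induction ν with
  | zero => exact absurd (Set.mem_univ p) h
  | succ ν ih =>
    by_cases hp : p ∈ ultK A ν
    · exact ⟨ν, Nat.lt_succ_self ν, by_contra fun hn => h ⟨hp, hn⟩⟩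
    · obtain ⟨μ, hμ, hk⟩ := ih hp
      exact ⟨μ, hμ.trans (Nat.lt_succ_self ν), hk⟩

theorem ncard_ultK_add_le {A : Mat n} {ν : ℕ} (h : ∀ μ < ν, ultLambda A μ ≠ 0) :
    (ultK A ν).ncard + ν ≤ n := by
  induction ν with
  | zero => simp [ultK]
  | succ ν ih =>
    obtain ⟨i, hi⟩ := exists_isNode_critEdge (h ν (Nat.lt_succ_self ν))
    have hlt : (ultK A (ν + 1)).ncard < (ultK A ν).ncard :=
      Set.ncard_lt_ncard ((Set.ssubset_iff_of_subset (ultK_succ_subset A ν)).2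
        ⟨i, mem_ultK_of_isNode hi, notMem_ultK_succ_of_isNode hi⟩)
    have := ih fun μ hμ => h μ (by omega)
    omega

theorem exists_ultLambda_eq_zero (A : Mat n) : ∃ μ ≤ n, ultLambda A μ = 0 := by
  by_contra! h
  have := ncard_ultK_add_le (A := A) (ν := n + 1) fun μ hμ => h μ (by omega)
  omega

theorem ultCount_le (A : Mat n) : ultCount A ≤ n :=
  let ⟨_, hμ, h⟩ := exists_ultLambda_eq_zero A
  (Nat.sInf_le h).trans hμ

theorem ultLambda_ultCount (A : Mat n) : ultLambda A (ultCount A) = 0 :=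
  let ⟨μ, _, h⟩ := exists_ultLambda_eq_zero A
  Nat.sInf_mem (s := {μ | ultLambda A μ = 0}) ⟨μ, h⟩

theorem ultLambda_ne_zero {A : Mat n} {μ : ℕ} (h : μ < ultCount A) : ultLambda A μ ≠ 0 :=
  Nat.notMem_of_lt_sInf h

theorem ultA_le (A : Mat n) (μ : ℕ) (i j : Fin n) : ultA A μ i j ≤ A i j := restrict_le _ _ _ _

theorem ultA_succ (A : Mat n) (μ : ℕ) :
    ultA A (μ + 1) = restrict (ultA A μ) (ultK A (μ + 1)) := by
  funext i j
  by_cases hij : i ∈ ultK A (μ + 1) ∧ j ∈ ultK A (μ + 1)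
  · simp [ultA, restrict, hij, ultK_succ_subset A μ hij.1, ultK_succ_subset A μ hij.2]
  · simp only [ultA, restrict, hij, if_false]

theorem ultLambda_succ_lt {A : Mat n} {μ : ℕ} (h : ultLambda A μ ≠ 0) :
    ultLambda A (μ + 1) < ultLambda A μ := by
  rw [ultLambda, ultA_succ]
  exact mcgm_restrict_lt h fun i hi hN => notMem_ultK_succ_of_isNode hN hi

theorem ultLambda_strictAntiOn (A : Mat n) :
    StrictAntiOn (ultLambda A) (Set.Iic (ultCount A)) :=
  strictAntiOn_Iic_of_succ_lt fun _ hμ => ultLambda_succ_lt (ultLambda_ne_zero hμ)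

theorem cyclicity_dvd_ultGamma {A : Mat n} {μ : ℕ} (h : μ < ultCount A) :
    cyclicity (CritEdge (ultA A μ)) ∣ ultGamma A :=
  Finset.dvd_lcm (f := fun μ => cyclicity (CritEdge (ultA A μ))) (Finset.mem_range.2 h)

theorem ultGamma_pos (A : Mat n) : 0 < ultGamma A := by
  rw [Nat.pos_iff_ne_zero, ultGamma, Ne, Finset.lcm_eq_zero_iff]
  rintro ⟨μ, -, h⟩
  exact (cyclicity_critEdge_pos _).ne' h

/-! The dominant term of an entry along a residue class -/

/-- There is a walk in the digraph of `A` from `i` to `j`, of length `r` modulo `ultGamma A`,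
through a critical node of the `ν`-th term. -/
def Visits (A : Mat n) (i j : Fin n) (r ν : ℕ) : Prop :=
  WalkThrough A (IsNode (CritEdge (ultA A ν))) (ultGamma A) r i j

-- A node of a walk that lies outside `ultK A ν` is in the component of a critical node `k` of an
-- earlier term; inserting `ultGamma A` copies of a closed walk through `k` keeps the residue.
theorem mem_ultK_of_walk {A : Mat n} {i p j : Fin n} {s s' r ν : ℕ}
    (hν : ∀ μ < ν, ¬ Visits A i j r μ) (hs : mpow A s i p ≠ 0) (hs' : mpow A s' p j ≠ 0)
    (hr : s + s' ≡ r [MOD ultGamma A]) : p ∈ ultK A ν := by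
  by_contra hp
  obtain ⟨μ, hμ, k, hk, hpk, hkp⟩ := exists_isNode_of_notMem_ultK hp
  obtain ⟨e, he⟩ := access_iff.1 hpk
  obtain ⟨f, hf⟩ := access_iff.1 hkp
  obtain ⟨g, hg⟩ := Nat.exists_eq_succ_of_ne_zero (ultGamma_pos A).ne'
  have hloop := mpow_mul_self_ne_zero (mpow_add_ne_zero he hf) g
  refine hν μ hμ ⟨k, s + e, f + (g * (e + f) + s'), hk, mpow_add_ne_zero hs he,
    mpow_add_ne_zero hf (mpow_add_ne_zero hloop hs'), ?_⟩
  have hlen : s + e + (f + (g * (e + f) + s')) = s + s' + ultGamma A * (e + f) := by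
    rw [hg, Nat.succ_mul]
    ring
  rw [hlen]
  exact Nat.ModEq.trans (Nat.left_modEq_add_iff.2 (dvd_mul_right _ _)).symm hr

theorem mpow_ultA_eq {A : Mat n} {i j : Fin n} {r ν t : ℕ} (hν : ∀ μ < ν, ¬ Visits A i j r μ)
    (ht : t ≡ r [MOD ultGamma A]) : mpow (ultA A ν) t i j = mpow A t i j :=
  mpow_restrict_eq fun _ _ _ hst hs hs' => mem_ultK_of_walk hν hs hs' (by rwa [hst])

theorem Visits.walkThrough_ultA {A : Mat n} {i j : Fin n} {r ν : ℕ} (h : Visits A i j r ν)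
    (hν : ∀ μ < ν, ¬ Visits A i j r μ) :
    WalkThrough (ultA A ν) (IsNode (CritEdge (ultA A ν))) (ultGamma A) r i j := by
  obtain ⟨k, a, b, hk, ha, hb, hab⟩ := h
  refine ⟨k, a, b, hk, ?_, ?_, hab⟩
  · rw [ultA, mpow_restrict_eq]
    · exact ha
    · rintro s s' p rfl hs hs'
      exact mem_ultK_of_walk hν hs (mpow_add_ne_zero hs' hb) (by rwa [← add_assoc])
  · rw [ultA, mpow_restrict_eq]
    · exact hb
    · rintro s s' p rfl hs hs'
      exact mem_ultK_of_walk hν (mpow_add_ne_zero ha hs) hs' (by rwa [add_assoc])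

/-- The number of the term that dominates the entries `(i, j)` of the powers `A ^ t` with
`t ≡ r` modulo `ultGamma A`; it is `ultCount A` if these entries ultimately vanish. -/
noncomputable def lead (A : Mat n) (i j : Fin n) (r : ℕ) : ℕ :=
  leastBelow (ultCount A) (Visits A i j r)

theorem lead_le (A : Mat n) (i j : Fin n) (r : ℕ) : lead A i j r ≤ ultCount A := leastBelow_le _ _

/-- The rate of growth of the entries `(i, j)` of the powers `A ^ t` with `t ≡ r` modulo
`ultGamma A`. -/
noncomputable def rate (A : Mat n) (i j : Fin n) (r : ℕ) : ℝ≥0 := ultLambda A (lead A i j r)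

theorem rate_lt_rate_iff {A : Mat n} {i i' j j' : Fin n} {r r' : ℕ} :
    rate A i j r < rate A i' j' r' ↔ lead A i' j' r' < lead A i j r :=
  (ultLambda_strictAntiOn A).lt_iff_gt (lead_le A i j r) (lead_le A i' j' r')

theorem rate_le_rate_iff {A : Mat n} {i i' j j' : Fin n} {r r' : ℕ} :
    rate A i j r ≤ rate A i' j' r' ↔ lead A i' j' r' ≤ lead A i j r :=
  (ultLambda_strictAntiOn A).le_iff_ge (lead_le A i j r) (lead_le A i' j' r')

theorem rate_ne_zero_iff {A : Mat n} {i j : Fin n} {r : ℕ} :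
    rate A i j r ≠ 0 ↔ lead A i j r < ultCount A := by
  refine ⟨fun h => (lead_le A i j r).lt_of_ne fun he => h ?_, ultLambda_ne_zero⟩
  rw [rate, he, ultLambda_ultCount]

theorem eventuallyGeometric_mpow (A : Mat n) (i j : Fin n) (r : ℕ) :
    EventuallyGeometric (atTopMod r (ultGamma A)) (fun t => mpow A t i j) (rate A i j r) := by
  have hν : ∀ μ < lead A i j r, ¬ Visits A i j r μ := fun _ => not_of_lt_leastBelow
  suffices h : EventuallyGeometric (atTopMod r (ultGamma A))
      (fun t => mpow (ultA A (lead A i j r)) t i j) (rate A i j r) from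
    h.congr (eventually_atTopMod.2 (Filter.Eventually.of_forall fun t => mpow_ultA_eq hν))
  rcases (lead_le A i j r).lt_or_eq with h | h
  · exact (Visits.walkThrough_ultA (leastBelow_spec h) hν).eventuallyGeometric (ultGamma_pos A)
      (cyclicity_dvd_ultGamma h)
  · have hrate : mcgm (ultA A (lead A i j r)) = 0 := h ▸ ultLambda_ultCount A
    change EventuallyGeometric _ _ (mcgm (ultA A (lead A i j r)))
    rw [hrate, eventuallyGeometric_zero_iff (atTopMod_le _ _)]
    filter_upwards [atTopMod_le _ _ (Filter.eventually_ge_atTop n)] with t ht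
    exact mpow_eq_zero_of_mcgm_eq_zero hrate ht i j

theorem ultU_one_ne_zero_iff {A : Mat n} {ν : ℕ} (h : ν < ultCount A) (i j : Fin n) :
    ultU A ν 1 i j ≠ 0 ↔
      WalkThrough (ultA A ν) (IsNode (CritEdge (ultA A ν))) (ultGamma A) 1 i j :=
  (csr_one_ne_zero_iff_walkThrough (ultLambda_ne_zero h) i j).trans
    ⟨fun hw => hw.of_cyclicity (ultGamma_pos A) (cyclicity_dvd_ultGamma h),
      fun hw => hw.of_dvd (cyclicity_dvd_ultGamma h)⟩

theorem lead_one_eq (A : Mat n) (i j : Fin n) :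
    lead A i j 1 = leastBelow (ultCount A) fun ν => ultU A ν 1 i j ≠ 0 := by
  refine le_antisymm (leastBelow_le_leastBelow fun h => ?_) (leastBelow_le_leastBelow fun h => ?_)
  · obtain ⟨k, a, b, hk, ha, hb, hab⟩ := (ultU_one_ne_zero_iff h i j).1 (leastBelow_spec h)
    exact ⟨k, a, b, hk, mpow_ne_zero_of_le (ultA_le A _) ha, mpow_ne_zero_of_le (ultA_le A _) hb,
      hab⟩
  · exact (ultU_one_ne_zero_iff h i j).2
      ((leastBelow_spec h).walkThrough_ultA fun _ => not_of_lt_leastBelow)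

theorem rate_le_rate {A : Mat n} {i p : Fin n} {s : ℕ} (hs : mpow A s i p ≠ 0) (j : Fin n)
    {r r' : ℕ} (hr : s + r ≡ r' [MOD ultGamma A]) : rate A p j r ≤ rate A i j r' :=
  rate_le_rate_iff.2 <|
    leastBelow_le_leastBelow fun h => ((leastBelow_spec h).prepend hs).congr hr

theorem exists_rate_one_eq {A : Mat n} {i j : Fin n} {r : ℕ} (h : rate A i j r ≠ 0) :
    ∃ q s, mpow A s i q ≠ 0 ∧ s + 1 ≡ r [MOD ultGamma A] ∧ rate A q j 1 = rate A i j r := by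
  have hlt := rate_ne_zero_iff.1 h
  obtain ⟨k, a, b, hk, ha, hb, hab⟩ : Visits A i j r (lead A i j r) := leastBelow_spec hlt
  obtain ⟨g, hg⟩ := Nat.exists_eq_succ_of_ne_zero (ultGamma_pos A).ne'
  obtain ⟨q, l, hq, hl, hdvd⟩ :=
    exists_crit_detour hk (ultGamma_pos A) (cyclicity_dvd_ultGamma hlt) (b + g)
  have hup : ∀ {t x y}, mpow (crit (ultA A (lead A i j r))) t x y ≠ 0 → mpow A t x y ≠ 0 :=
    fun ht => mpow_ne_zero_of_le (fun x y => (crit_le _ x y).trans (ultA_le A _ x y)) ht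
  have hs : mpow A (a + (b + g)) i q ≠ 0 := mpow_add_ne_zero ha (hup hq)
  have hsr : a + (b + g) + 1 ≡ r [MOD ultGamma A] := by
    rw [show a + (b + g) + 1 = a + b + ultGamma A by omega]
    exact Nat.add_modEq_right.trans hab
  have hlb : l + b ≡ 1 [MOD ultGamma A] := by
    refine Nat.ModEq.add_right_cancel' g ?_
    rw [show l + b + g = b + g + l by omega, show 1 + g = ultGamma A by omega]
    exact ((Nat.modEq_zero_iff_dvd).2 hdvd).trans ((Nat.modEq_zero_iff_dvd).2 dvd_rfl).symm
  refine ⟨q, _, hs, hsr, le_antisymm (rate_le_rate hs j hsr) ?_⟩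
  exact rate_le_rate_iff.2 (leastBelow_le_of ⟨k, l, b, hk, hup hl, hb, hlb⟩)

/-! Orbits -/

/-- The rate of growth of the `i`-th entries of the vectors `A ^ t ⊗ y` with `t ≡ r` modulo
`ultGamma A`, where `S` is the support of `y`. -/
noncomputable def orbitRate (A : Mat n) (S : Finset (Fin n)) (i : Fin n) (r : ℕ) : ℝ≥0 :=
  S.sup fun j => rate A i j r

theorem eventuallyGeometric_mvec (A : Mat n) (y : Fin n → ℝ≥0) (i : Fin n) (r : ℕ) :
    EventuallyGeometric (atTopMod r (ultGamma A)) (fun t => mvec (mpow A t) y i)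
      (orbitRate A {j | y j ≠ 0} i r) := by
  have hsup : ∀ t, mvec (mpow A t) y i =
      ({j | y j ≠ 0} : Finset (Fin n)).sup fun j => mpow A t i j * y j := by
    intro t
    refine le_antisymm (Finset.sup_le fun j _ => ?_) (Finset.sup_mono (Finset.subset_univ _))
    rcases eq_or_ne (y j) 0 with hj | hj
    · simp [hj]
    · exact Finset.le_sup (f := fun j => mpow A t i j * y j) (by simpa using hj)
  simp only [hsup]
  exact EventuallyGeometric.finset_sup (atTopMod_le _ _) fun j hj =>
    (eventuallyGeometric_mpow A i j r).mul_const (by simpa using hj)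

theorem orbitPeriodic_iff_orbitRate (A : Mat n) :
    OrbitPeriodic A ↔ ∀ S i i' r r', orbitRate A S i r ≠ 0 → orbitRate A S i' r' ≠ 0 →
      orbitRate A S i r = orbitRate A S i' r' := by
  classical
  have hperiodic : OrbitPeriodic A ↔ ∀ y : Fin n → ℝ≥0, ∃ l, ∀ i r,
      orbitRate A {j | y j ≠ 0} i r = 0 ∨ l = orbitRate A {j | y j ≠ 0} i r := by
    simp only [← (eventuallyGeometric_mvec A _ _ _).eventually_add_eq_iff (ultGamma_pos A),
      ← eventually_atTop_iff_atTopMod (ultGamma_pos A), ← Filter.eventually_all, OrbitPeriodic,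
      funext_iff, Pi.smul_apply, smul_eq_mul]
  rw [hperiodic]
  constructor
  · intro h S i i' r r' hi hi'
    obtain ⟨l, hl⟩ := h fun j => if j ∈ S then 1 else 0
    simp only [ne_eq, ite_eq_right_iff, one_ne_zero, imp_false, not_not, Finset.filter_univ_mem]
      at hl
    rw [← (hl i r).resolve_left hi, ← (hl i' r').resolve_left hi']
  · intro h y
    by_cases h0 : ∃ i r, orbitRate A {j | y j ≠ 0} i r ≠ 0
    · obtain ⟨i, r, hi⟩ := h0
      exact ⟨_, fun i' r' => or_iff_not_imp_left.2 (h _ i i' r r' hi)⟩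
    · push Not at h0
      exact ⟨0, fun i r => Or.inl (h0 i r)⟩

theorem rate_le_rate_of_orbitRate_eq {A : Mat n}
    (h : ∀ S i i' r r', orbitRate A S i r ≠ 0 → orbitRate A S i' r' ≠ 0 →
      orbitRate A S i r = orbitRate A S i' r') {i i' j k : Fin n} {r : ℕ}
    (h0 : rate A i k r ≠ 0) (hlt : rate A i k r < rate A i' j r) :
    rate A i' j r ≤ rate A i j r := by
  classical
  have hS : ∀ x, orbitRate A {j, k} x r = rate A x j r ⊔ rate A x k r := fun x => by
    simp [orbitRate]
  by_contra! hj
  have heq := h {j, k} i i' r r (hS i ▸ ne_bot_of_le_ne_bot h0 le_sup_right)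
    (hS i' ▸ ne_bot_of_le_ne_bot hlt.ne_bot le_sup_left)
  rw [hS, hS] at heq
  exact (sup_lt_iff.2 ⟨hj, hlt⟩).not_ge (heq ▸ le_sup_left)

theorem exists_rate_eq_orbitRate {A : Mat n} {S : Finset (Fin n)} {i : Fin n} {r : ℕ}
    (h : orbitRate A S i r ≠ 0) : ∃ j ∈ S, rate A i j r = orbitRate A S i r := by
  have hS : S.Nonempty := Finset.nonempty_iff_ne_empty.2 fun hS => h (by simp [hS, orbitRate])
  obtain ⟨j, hj, heq⟩ := Finset.exists_mem_eq_sup S hS fun j => rate A i j r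
  exact ⟨j, hj, heq.symm⟩

-- Both entries of the orbit are moved to residue `1`, where the condition on the rates applies.
theorem orbitRate_le_of_rate {A : Mat n}
    (h : ∀ i i' j k, rate A i k 1 ≠ 0 → rate A i k 1 < rate A i' j 1 →
      rate A i' j 1 ≤ rate A i j 1) {S : Finset (Fin n)} {i i' : Fin n} {r r' : ℕ}
    (hi : orbitRate A S i r ≠ 0) (hi' : orbitRate A S i' r' ≠ 0) :
    orbitRate A S i' r' ≤ orbitRate A S i r := by
  by_contra! hlt
  obtain ⟨j, hjS, hj⟩ := exists_rate_eq_orbitRate hi'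
  obtain ⟨k, -, hk⟩ := exists_rate_eq_orbitRate hi
  obtain ⟨q', -, -, -, hq'⟩ := exists_rate_one_eq (hj.trans_ne hi')
  obtain ⟨q, s, hs, hsr, hq⟩ := exists_rate_one_eq (hk.trans_ne hi)
  rw [hj] at hq'
  rw [hk] at hq
  refine hlt.not_ge ?_
  calc orbitRate A S i' r' = rate A q' j 1 := hq'.symm
    _ ≤ rate A q j 1 := h q q' j k (hq.trans_ne hi) (hq.trans_lt (hlt.trans_eq hq'.symm))
    _ ≤ rate A i j r := rate_le_rate hs j hsr
    _ ≤ orbitRate A S i r := Finset.le_sup (f := fun j => rate A i j r) hjS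

theorem orbitPeriodic_iff (A : Mat n) :
    OrbitPeriodic A ↔ ∀ i i' j k, lead A i k 1 < ultCount A → lead A i' j 1 < lead A i k 1 →
      lead A i j 1 ≤ lead A i' j 1 := by
  simp only [orbitPeriodic_iff_orbitRate, ← rate_ne_zero_iff, ← rate_lt_rate_iff,
    ← rate_le_rate_iff]
  exact ⟨fun h _ _ _ _ => rate_le_rate_of_orbitRate_eq h, fun h S i i' r r' hi hi' =>
    le_antisymm (orbitRate_le_of_rate h hi' hi) (orbitRate_le_of_rate h hi hi')⟩

end MaxAlg

namespace RAM

/-- Started in `s`, the program `p` halts after at most `B` steps in a state satisfying `Q`: a Hoare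
triple for total correctness, with a time bound. -/
def Runs (p : Prog) (s : State) (B : ℕ) (Q : State → Prop) : Prop :=
  ∃ t T, Exec p s t T ∧ T ≤ B ∧ Q t

theorem Runs.weaken {p : Prog} {s : State} {B B' : ℕ} {Q Q' : State → Prop} (h : Runs p s B Q)
    (hB : B ≤ B') (hQ : ∀ t, Q t → Q' t) : Runs p s B' Q' :=
  let ⟨t, T, he, hT, hq⟩ := h
  ⟨t, T, he, hT.trans hB, hQ t hq⟩

theorem Runs.op {o : Op} {s : State} {Q : State → Prop} (h : Q (o.run s)) : Runs (.op o) s 1 Q :=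
  ⟨_, 1, .op o s, le_rfl, h⟩

theorem Runs.seq {p q : Prog} {s : State} {B B' : ℕ} {Q : State → Prop}
    (h : Runs p s B fun t => Runs q t B' Q) : Runs (.seq p q) s (B + B') Q :=
  let ⟨_, _, he, hT, t, _, he', hT', hq⟩ := h
  ⟨t, _, .seq he he', add_le_add hT hT', hq⟩

theorem Runs.op_seq {o : Op} {q : Prog} {s : State} {B : ℕ} {Q : State → Prop}
    (h : Runs q (o.run s) B Q) : Runs (.seq (.op o) q) s (B + 1) Q :=
  add_comm B 1 ▸ Runs.seq (Runs.op h)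

theorem Runs.ite {b : Test} {p q : Prog} {s : State} {B : ℕ} {Q : State → Prop}
    (h₁ : b.Holds s → Runs p s B Q) (h₂ : ¬ b.Holds s → Runs q s B Q) :
    Runs (.ite b p q) s (B + 1) Q := by
  by_cases hb : b.Holds s
  · obtain ⟨t, T, he, hT, hq⟩ := h₁ hb
    exact ⟨t, T + 1, .ite_true hb he, by omega, hq⟩
  · obtain ⟨t, T, he, hT, hq⟩ := h₂ hb
    exact ⟨t, T + 1, .ite_false hb he, by omega, hq⟩

/-- `for r = 0, …, (content of register b) - 1 do body`. -/
def forLoop (r b : ℕ) (body : Prog) : Prog :=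
  .seq (.op (.constI r 0)) (.loop (.ltI r b) (.seq body (.op (.succI r))))

theorem Runs.forLoop {r b : ℕ} {body : Prog} {s : State} {N B : ℕ} (I : ℕ → State → Prop)
    (h0 : I 0 (s.setI r 0)) (hI : ∀ k t, I k t → t.ireg r = k ∧ t.ireg b = N)
    (hbody : ∀ k < N, ∀ t, I k t →
      Runs body t B fun t' => I (k + 1) (t'.setI r (t'.ireg r + 1))) :
    Runs (RAM.forLoop r b body) s (N * (B + 2) + 2) (I N) := by
  have from_step : ∀ d k t, k + d = N → I k t →
      Runs (.loop (.ltI r b) (.seq body (.op (.succI r)))) t (d * (B + 2) + 1) (I N) := by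
    intro d
    induction d with
    | zero =>
      rintro k t rfl hk
      have := hI k t hk
      exact ⟨t, 1, .loop_done (by simp only [Test.Holds]; omega), by omega, hk⟩
    | succ d ih =>
      intro k t hkd hk
      have := hI k t hk
      obtain ⟨t', T, he, hT, hq⟩ := hbody k (by omega) t hk
      obtain ⟨t'', T', he', hT', hq'⟩ := ih (k + 1) _ (by omega) hq
      refine ⟨t'', T + 1 + T' + 1,
        .loop_step (by simp only [Test.Holds]; omega) (.seq he (.op _ _)) he', ?_, hq'⟩
      rw [Nat.succ_mul]; omega
  exact Runs.op_seq (o := .constI r 0) (from_step N 0 _ (by omega) h0)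

/-- The states `s` and `t` have the same index registers outside `R` and the same real arrays; real
registers and integer arrays may differ. -/
structure AgreeOff (R : Finset ℕ) (s t : State) : Prop where
  ireg : ∀ r ∉ R, t.ireg r = s.ireg r
  rarr : t.rarr = s.rarr

theorem AgreeOff.refl (R : Finset ℕ) (s : State) : AgreeOff R s s := ⟨fun _ _ => rfl, rfl⟩

theorem AgreeOff.mono {R R' : Finset ℕ} {s t : State} (h : AgreeOff R s t) (hR : R ⊆ R') :
    AgreeOff R' s t :=
  ⟨fun r hr => h.ireg r fun hr' => hr (hR hr'), h.rarr⟩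

theorem AgreeOff.trans {R : Finset ℕ} {s t u : State} (h : AgreeOff R s t)
    (h' : AgreeOff R t u) : AgreeOff R s u :=
  ⟨fun r hr => (h'.ireg r hr).trans (h.ireg r hr), h'.rarr.trans h.rarr⟩

theorem State.setI_ireg_self (s : State) (r v : ℕ) : (s.setI r v).ireg r = v :=
  Function.update_self ..

theorem AgreeOff.setI {R : Finset ℕ} {s t : State} {r : ℕ} (h : AgreeOff R s t) (hr : r ∈ R)
    (v : ℕ) : AgreeOff R s (t.setI r v) :=
  ⟨fun r' hr' => (Function.update_of_ne (ne_of_mem_of_not_mem hr hr').symm _ _).trans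
    (h.ireg r' hr'), h.rarr⟩

/-- Started in `s`, the program `p` puts `v` into register `x` after at most `B` steps, without
side effects apart from changes to the index registers in `R` and to the real registers. -/
def Evaluates (p : Prog) (R : Finset ℕ) (x : ℕ) (s : State) (B v : ℕ) : Prop :=
  Runs p s B fun t => AgreeOff R s t ∧ t.iarr = s.iarr ∧ t.ireg x = v

theorem Evaluates.assign {o : Op} {x v : ℕ} {s : State} (h : o.run s = s.setI x v) :
    Evaluates (.op o) {x} x s 1 v := by
  refine Runs.op ?_
  rw [h]
  exact ⟨(AgreeOff.refl _ s).setI (Finset.mem_singleton_self x) v, rfl, s.setI_ireg_self x v⟩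

theorem Evaluates.op_seq {o : Op} {q : Prog} {R : Finset ℕ} {x : ℕ} {s : State} {B v : ℕ}
    (ho : AgreeOff R s (o.run s)) (harr : (o.run s).iarr = s.iarr)
    (h : Evaluates q R x (o.run s) B v) : Evaluates (.seq (.op o) q) R x s (B + 1) v :=
  Runs.op_seq (Runs.weaken h le_rfl fun _ ⟨ht, ha, hx⟩ => ⟨ho.trans ht, ha.trans harr, hx⟩)

theorem Evaluates.seq {p q : Prog} {R R' S : Finset ℕ} {x y : ℕ} {s : State} {B B' v w : ℕ}
    (hR : R ⊆ S) (hR' : R' ⊆ S) (h : Evaluates p R x s B v)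
    (h' : ∀ t, AgreeOff R s t → t.iarr = s.iarr → t.ireg x = v → Evaluates q R' y t B' w) :
    Evaluates (.seq p q) S y s (B + B') w :=
  Runs.seq (Runs.weaken h le_rfl fun t ⟨ht, ha, hx⟩ => Runs.weaken (h' t ht ha hx) le_rfl
    fun _ ⟨hu, ha', hy⟩ => ⟨(ht.mono hR).trans (hu.mono hR'), ha'.trans ha, hy⟩)

/-- Puts into register `a` the minimum of the content of register `z` and of all values that
`value` puts into register `x` for `r = 0, …, (content of register b) - 1`. -/
def minLoop (r b x a z : ℕ) (value : Prog) : Prog :=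
  .seq (.op (.copyI a z))
    (forLoop r b (.seq value (.ite (.ltI x a) (.op (.copyI a x)) .skip)))

theorem Runs.setMin {x a : ℕ} {s : State} {Q : State → Prop}
    (h : Q (s.setI a (min (s.ireg a) (s.ireg x)))) :
    Runs (.ite (.ltI x a) (.op (.copyI a x)) .skip) s 2 Q := by
  refine Runs.ite (B := 1) (fun hb => Runs.op ?_) fun hb => ⟨s, 1, .skip s, le_rfl, ?_⟩
  · rwa [min_eq_right (le_of_lt hb)] at h
  · rwa [min_eq_left (not_lt.1 hb), State.setI, Function.update_eq_self] at h

theorem Evaluates.minLoop {r b x a z N B : ℕ} {value : Prog} {R : Finset ℕ} {s : State}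
    {f : ℕ → ℕ} (hN : s.ireg b = N) (hb : b ∉ insert r (insert a R)) (hr : r ∉ insert a R)
    (ha : a ∉ R)
    (hvalue : ∀ k < N, ∀ t, AgreeOff (insert r (insert a R)) s t → t.iarr = s.iarr →
      t.ireg r = k → Evaluates value R x t B (f k)) :
    Evaluates (RAM.minLoop r b x a z value) (insert r (insert a R)) a s (N * (B + 4) + 3)
      ((Finset.range N).fold min (s.ireg z) f) := by
  have hra : r ≠ a := fun h => hr (h ▸ Finset.mem_insert_self a R)
  have hrR : r ∉ R := fun h => hr (Finset.mem_insert_of_mem h)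
  have hmem : a ∈ insert r (insert a R) := by simp
  have hsub : R ⊆ insert r (insert a R) := fun _ h => by simp [h]
  refine (Runs.op_seq (Runs.forLoop (B := B + 2) (N := N) (fun k t =>
    AgreeOff (insert r (insert a R)) s t ∧ t.iarr = s.iarr ∧ t.ireg r = k ∧
      t.ireg a = (Finset.range k).fold min (s.ireg z) f) ?init ?regs ?body)).weaken
    le_rfl fun t ⟨ht, harr, _, hacc⟩ => ⟨ht, harr, hacc⟩
  case init =>
    refine ⟨((AgreeOff.refl _ s).setI hmem _).setI (by simp) _, rfl, Function.update_self .., ?_⟩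
    simp [Op.run, State.setI, hra.symm]
  case regs =>
    rintro k t ⟨ht, -, hk, -⟩
    exact ⟨hk, (ht.ireg b hb).trans hN⟩
  case body =>
    rintro k hk t ⟨ht, harr, htr, hta⟩
    refine Runs.seq (Runs.weaken (hvalue k hk t ht harr htr) le_rfl ?_)
    rintro u ⟨hu, huarr, hux⟩
    refine Runs.setMin ⟨((ht.trans (hu.mono hsub)).setI hmem _).setI (by simp) _,
      huarr.trans harr, ?_, ?_⟩
    · simp [State.setI, hra, hu.ireg r hrR, htr]
    · simp [State.setI, hra.symm, hu.ireg a ha, hta, hux, Finset.range_add_one, min_comm]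

theorem Evaluates.existsLoop {r b x a z N B : ℕ} {value : Prog} {R : Finset ℕ} {s : State}
    {P : ℕ → Prop} [DecidablePred P] [Decidable (∃ k < N, P k)] (hz : s.ireg z = 1)
    (hN : s.ireg b = N) (hb : b ∉ insert r (insert a R))
    (hr : r ∉ insert a R) (ha : a ∉ R)
    (hvalue : ∀ k < N, ∀ t, AgreeOff (insert r (insert a R)) s t → t.iarr = s.iarr →
      t.ireg r = k → Evaluates value R x t B (if P k then 0 else 1)) :
    Evaluates (RAM.minLoop r b x a z value) (insert r (insert a R)) a s (N * (B + 4) + 3)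
      (if ∃ k < N, P k then 0 else 1) := by
  have h := Evaluates.minLoop (z := z) hN hb hr ha hvalue
  rwa [hz, fold_min_indicator_not] at h

/-- Puts `0` into register `x` if all tests in the list succeed, and `1` otherwise. -/
def notAll (x : ℕ) : List Test → Prog
  | [] => .op (.constI x 0)
  | b :: l => .ite b (notAll x l) (.op (.constI x 1))

open Classical in
theorem evaluates_notAll (x : ℕ) (l : List Test) (s : State) :
    Evaluates (notAll x l) {x} x s (l.length + 1) (if ∀ b ∈ l, b.Holds s then 0 else 1) := by
  induction l with
  | nil =>
    rw [if_pos fun b hb => absurd hb List.not_mem_nil]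
    exact Evaluates.assign rfl
  | cons b l ih =>
    refine Runs.ite (fun hb => ?_) fun hb => ?_
    · simp only [List.forall_mem_cons, hb, true_and]
      exact ih
    · rw [if_neg fun h => hb (h b List.mem_cons_self)]
      exact Runs.weaken (Evaluates.assign rfl) (by simp) fun _ h => h

/-- Fills array `a` with the values that `value` puts into register `x` when registers `p` and `q`
run through all pairs of numbers below the content of register `b`. -/
def fillTable (a p q x b : ℕ) (value : Prog) : Prog :=
  forLoop p b (forLoop q b (.seq value (.op (.storeI a p q x))))

theorem runs_fillRow {a p q x b N B i : ℕ} {value : Prog} {R : Finset ℕ} {s : State} {f : ℕ → ℕ}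
    (hN : s.ireg b = N) (hi : s.ireg p = i) (hb : b ∉ insert q R) (hp : p ∉ insert q R)
    (hq : q ∉ R)
    (hvalue : ∀ j < N, ∀ t, AgreeOff (insert q R) s t → t.ireg q = j →
      Evaluates value R x t B (f j)) :
    Runs (forLoop q b (.seq value (.op (.storeI a p q x)))) s (N * (B + 3) + 2) fun t =>
      AgreeOff (insert q R) s t ∧ (∀ i' ≠ i, t.iarr a i' = s.iarr a i') ∧
        ∀ j < N, t.iarr a i j = f j := by
  refine (Runs.forLoop (B := B + 1) (N := N) (fun k t => AgreeOff (insert q R) s t ∧ t.ireg q = k ∧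
    (∀ i' ≠ i, t.iarr a i' = s.iarr a i') ∧ ∀ j < k, t.iarr a i j = f j)
    ⟨(AgreeOff.refl _ s).setI (by simp) 0, Function.update_self .., fun _ _ => rfl, by simp⟩
    (fun k t ⟨ht, hk, _⟩ => ⟨hk, (ht.ireg b hb).trans hN⟩) ?_).weaken le_rfl
    fun t ⟨ht, _, h⟩ => ⟨ht, h⟩
  rintro k hk t ⟨ht, htq, hrows, hrow⟩
  refine Runs.seq (Runs.weaken (hvalue k hk t ht htq) le_rfl ?_)
  rintro u ⟨hu, harr, hx⟩
  have hsu : AgreeOff (insert q R) s u := ht.trans (hu.mono (Finset.subset_insert q R))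
  have huq : u.ireg q = k := (hu.ireg q hq).trans htq
  have hup : u.ireg p = i := (hsu.ireg p hp).trans hi
  have hstore : AgreeOff (insert q R) s ((Op.storeI a p q x).run u) := ⟨hsu.ireg, hsu.rarr⟩
  refine Runs.op ⟨hstore.setI (by simp) _, ?_, fun i' hi' => ?_, fun j hj => ?_⟩
  · simp [Op.run, State.setI, huq]
  · funext j
    simp [Op.run, State.setI, hup, hi', harr, hrows i' hi']
  · rcases eq_or_ne j k with rfl | hjk
    · simp [Op.run, State.setI, hup, huq, hx]
    · simpa [Op.run, State.setI, huq, hjk, harr] using hrow j (by omega)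

theorem runs_fillTable {a p q x b N B : ℕ} {value : Prog} {R : Finset ℕ} {s : State}
    {f : ℕ → ℕ → ℕ} (hN : s.ireg b = N) (hb : b ∉ insert p (insert q R)) (hp : p ∉ insert q R)
    (hq : q ∉ R)
    (hvalue : ∀ i < N, ∀ j < N, ∀ t, AgreeOff (insert p (insert q R)) s t → t.ireg p = i →
      t.ireg q = j → Evaluates value R x t B (f i j)) :
    Runs (fillTable a p q x b value) s (N * (N * (B + 3) + 4) + 2) fun t =>
      AgreeOff (insert p (insert q R)) s t ∧ ∀ i < N, ∀ j < N, t.iarr a i j = f i j := by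
  have hb' : b ∉ insert q R := fun h => hb (Finset.mem_insert_of_mem h)
  have hsub : insert q R ⊆ insert p (insert q R) := Finset.subset_insert _ _
  refine (Runs.forLoop (B := N * (B + 3) + 2) (N := N) (fun k t =>
    AgreeOff (insert p (insert q R)) s t ∧ t.ireg p = k ∧
      ∀ i < k, ∀ j < N, t.iarr a i j = f i j)
    ⟨(AgreeOff.refl _ s).setI (by simp) 0, Function.update_self .., by simp⟩
    (fun k t ⟨ht, hk, _⟩ => ⟨hk, (ht.ireg b hb).trans hN⟩) ?_).weaken le_rfl
    fun t ⟨ht, _, h⟩ => ⟨ht, h⟩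
  rintro k hk t ⟨ht, htp, htable⟩
  refine (runs_fillRow ((ht.ireg b hb).trans hN) htp hb' hp hq fun j hj u hu huq =>
    hvalue k hk j hj u (ht.trans (hu.mono hsub)) ((hu.ireg p hp).trans htp) huq).weaken le_rfl ?_
  rintro u ⟨hu, hrows, hrow⟩
  refine ⟨(ht.trans (hu.mono hsub)).setI (by simp) _, ?_, fun i hi j hj => ?_⟩
  · simp [State.setI, hu.ireg p hp, htp]
  · rcases eq_or_ne i k with rfl | hik
    · exact hrow j hj
    · exact (congrFun (hrows i hik) j).trans (htable i (by omega) j hj)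

/-- Puts into register `8` the least `ν` below the content of register `2` such that the entry of
the `ν`-th matrix in real array `2` at the indices in registers `5` and `6` does not vanish. -/
def leadProg : Prog :=
  minLoop 7 2 9 8 2 (.seq (.op (.loadR 1 2 7 5 6)) (.seq (.op (.zeroR 0))
    (.ite (.eqR 1 0) (.op (.copyI 9 2)) (.op (.copyI 9 7)))))

theorem evaluates_leadProg (s : State) : Evaluates leadProg {7, 8, 9} 8 s (s.ireg 2 * 8 + 3)
    (leastBelow (s.ireg 2) fun ν => s.rarr 2 ν (s.ireg 5) (s.ireg 6) ≠ 0) := by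
  classical
  rw [← fold_min_eq_leastBelow]
  refine Evaluates.minLoop (R := {9}) (B := 4) rfl (by decide) (by decide) (by decide)
    fun k _ t ht _ htk => .op_seq ⟨fun _ _ => rfl, rfl⟩ rfl (.op_seq ⟨fun _ _ => rfl, rfl⟩ rfl ?_)
  set u := (Op.zeroR 0).run ((Op.loadR 1 2 7 5 6).run t)
  have hentry : (Test.eqR 1 0).Holds u ↔ s.rarr 2 k (s.ireg 5) (s.ireg 6) = 0 := by
    simp [u, Test.Holds, Op.run, State.setR, htk, ht.rarr, ht.ireg 5, ht.ireg 6]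
  refine Runs.ite (fun h => ?_) fun h => ?_
  · rw [if_neg (not_not.2 (hentry.1 h)), ← ht.ireg 2 (by decide)]
    exact Evaluates.assign rfl
  · rw [if_pos fun h' => h (hentry.2 h'), ← htk]
    exact Evaluates.assign rfl

/-- The minimum of `m` and the first `n` entries of column `j` of the table `g`. -/
def columnMin (n m : ℕ) (g : ℕ → ℕ → ℕ) (j : ℕ) : ℕ := (Finset.range n).fold min m fun i => g i j

/-- Violation of the criterion for orbit periodicity at `i`, `j`, `k`, where `g` is the table of
leading terms. -/
def Violates (n m : ℕ) (g : ℕ → ℕ → ℕ) (i j k : ℕ) : Prop :=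
  columnMin n m g j < g i k ∧ g i k < m ∧ columnMin n m g j < g i j

/-- Puts into register `11` the number `0` if `Violates n m g i j k`, and `1` otherwise. Registers
`2`, `5`, `6`, `7`, `10` hold `m`, `i`, `j`, `k`, `columnMin n m g j`, and integer array `2` is
`g`. -/
def violationProg : Prog :=
  .seq (.op (.loadI 8 2 5 7)) (.seq (.op (.loadI 9 2 5 6))
    (notAll 11 [.ltI 10 8, .ltI 8 2, .ltI 10 9]))

open Classical in
theorem evaluates_violation {n m : ℕ} {g : ℕ → ℕ → ℕ} {s : State} (hm : s.ireg 2 = m)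
    (hmin : s.ireg 10 = columnMin n m g (s.ireg 6))
    (hj : s.iarr 2 (s.ireg 5) (s.ireg 6) = g (s.ireg 5) (s.ireg 6))
    (hk : s.iarr 2 (s.ireg 5) (s.ireg 7) = g (s.ireg 5) (s.ireg 7)) :
    Evaluates violationProg {8, 9, 11} 11 s 6
      (if Violates n m g (s.ireg 5) (s.ireg 6) (s.ireg 7) then 0 else 1) := by
  have hset {u : State} {r v : ℕ} (hr : r ∈ ({8, 9, 11} : Finset ℕ)) :
      AgreeOff {8, 9, 11} u (u.setI r v) := (AgreeOff.refl _ u).setI hr v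
  refine .op_seq (hset (by decide)) rfl (.op_seq (hset (by decide)) rfl
    (Runs.weaken (evaluates_notAll 11 _ _) le_rfl ?_))
  rintro t ⟨ht, harr, htx⟩
  refine ⟨ht.mono (by decide), harr, htx.trans (if_congr ?_ rfl rfl)⟩
  simp [Violates, Test.Holds, Op.run, State.setI, hm, hmin, hj, hk]

/-- Puts into register `13` the number `0` if `Violates n m g i j k` for some `i` and `k`, and `1`
otherwise. Registers `0`, `2`, `3`, `6` hold `n`, `m`, `1`, `j`, and integer array `2` is `g`. -/
def columnProg : Prog :=
  .seq (minLoop 5 0 9 10 2 (.op (.loadI 9 2 5 6)))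
    (minLoop 5 0 12 13 3 (minLoop 7 0 11 12 3 violationProg))

open Classical in
theorem evaluates_columnProg {n m : ℕ} {g : ℕ → ℕ → ℕ} {s : State} (hn : s.ireg 0 = n)
    (hm : s.ireg 2 = m) (h1 : s.ireg 3 = 1) (hg : ∀ i < n, ∀ j < n, s.iarr 2 i j = g i j)
    (hj : s.ireg 6 < n) :
    Evaluates columnProg {5, 7, 8, 9, 10, 11, 12, 13} 13 s
      (n * 5 + 3 + (n * (n * 10 + 7) + 3))
      (if ∃ i < n, ∃ k < n, Violates n m g i (s.ireg 6) k then 0 else 1) := by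
  have hcolumn : Evaluates (minLoop 5 0 9 10 2 (.op (.loadI 9 2 5 6))) {5, 10, 9} 10 s
      (n * 5 + 3) (columnMin n m g (s.ireg 6)) := by
    rw [columnMin, ← hm]
    refine Evaluates.minLoop (R := {9}) (B := 1) hn (by decide) (by decide) (by decide)
      fun i hi t ht harr hti => ?_
    rw [← hg i hi _ hj, ← harr, ← hti, ← ht.ireg 6 (by decide)]
    exact Evaluates.assign rfl
  refine Evaluates.seq (R' := {5, 13, 7, 12, 8, 9, 11}) (by decide) (by decide) hcolumn
    fun t ht htarr hmin => ?_
  refine Evaluates.existsLoop (r := 5) (a := 13) (R := {7, 12, 8, 9, 11}) (B := n * 10 + 3)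
    ((ht.ireg 3 (by decide)).trans h1) ((ht.ireg 0 (by decide)).trans hn) (by decide) (by decide)
    (by decide) fun i hi u hu huarr hui => ?_
  have hsu : AgreeOff {5, 13, 7, 12, 8, 9, 11, 10} s u :=
    (ht.mono (by decide)).trans (hu.mono (by decide))
  refine Evaluates.existsLoop (r := 7) (a := 12) (R := {8, 9, 11}) (B := 6)
    ((hsu.ireg 3 (by decide)).trans h1)
    ((hsu.ireg 0 (by decide)).trans hn) (by decide) (by decide) (by decide)
    fun k hk v hv hvarr hvk => ?_
  have hsv := hsu.trans (hv.mono (by decide))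
  have hv5 : v.ireg 5 = i := (hv.ireg 5 (by decide)).trans hui
  have hv6 : v.ireg 6 = s.ireg 6 := hsv.ireg 6 (by decide)
  have hvg : ∀ i < n, ∀ j < n, v.iarr 2 i j = g i j := by rwa [hvarr, huarr, htarr]
  rw [← hv5, ← hv6, ← hvk]
  refine evaluates_violation ((hsv.ireg 2 (by decide)).trans hm) ?_ (hvg _ ?_ _ ?_) (hvg _ ?_ _ ?_)
  · rw [hv.ireg 10 (by decide), hu.ireg 10 (by decide), hmin, hv6]
  all_goals simpa only [hv5, hv6, hvk]

/-- Decides whether the table of leading terms violates the criterion for orbit periodicity; the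
answer is left in register `0`. -/
def orbitProg : Prog :=
  .seq (fillTable 2 5 6 8 0 leadProg) (.seq (.op (.constI 3 1))
    (.seq (minLoop 6 0 13 14 3 columnProg) (.op (.copyI 0 14))))

theorem orbitProg_time_le {n m : ℕ} (hmn : m ≤ n) (hn : 1 ≤ n) :
    n * (n * (m * 8 + 3 + 3) + 4) + 2 +
      (n * (n * 5 + 3 + (n * (n * 10 + 7) + 3) + 4) + 3 + 1 + 1) ≤ 60 * n ^ 3 := by
  have h₁ : n * n * m ≤ n * n * n := Nat.mul_le_mul_left _ hmn
  have h₂ : n * n ≤ n * n * n := Nat.le_mul_of_pos_right _ hn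
  have h₃ : n ≤ n * n := Nat.le_mul_of_pos_right _ hn
  ring_nf at h₁ h₂ h₃ ⊢
  omega

open Classical in
theorem runs_orbitProg {n m : ℕ} {g : ℕ → ℕ → ℕ} {s : State} (hn : s.ireg 0 = n)
    (hm : s.ireg 2 = m) (hmn : m ≤ n) (hn1 : 1 ≤ n)
    (hg : ∀ i < n, ∀ j < n, leastBelow m (fun ν => s.rarr 2 ν i j ≠ 0) = g i j) :
    Runs orbitProg s (60 * n ^ 3) fun t =>
      t.ireg 0 = if ∃ j < n, ∃ i < n, ∃ k < n, Violates n m g i j k then 0 else 1 := by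
  have htable := runs_fillTable (a := 2) (p := 5) (q := 6) (R := {7, 8, 9}) (f := g)
    (B := m * 8 + 3) hn (by decide) (by decide) (by decide) fun i hi j hj t ht hti htj => by
      have h := evaluates_leadProg t
      rwa [ht.ireg 2 (by decide), hm, ht.rarr, hti, htj, hg i hi j hj] at h
  refine Runs.weaken (Runs.seq (Runs.weaken htable le_rfl ?_)) (orbitProg_time_le hmn hn1)
    fun _ h => h
  rintro t ⟨ht, htg⟩
  refine Runs.op_seq (Runs.seq (B' := 1) ?_)
  set u := (Op.constI 3 1).run t
  have hu : AgreeOff {3, 5, 6, 7, 8, 9} s u := (ht.mono (by decide)).setI (by decide) 1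
  have hu3 : u.ireg 3 = 1 := t.setI_ireg_self 3 1
  have hscan : Evaluates (minLoop 6 0 13 14 3 columnProg) {6, 14, 5, 7, 8, 9, 10, 11, 12, 13} 14 u
      _ (if ∃ j < n, ∃ i < n, ∃ k < n, Violates n m g i j k then 0 else 1) :=
    Evaluates.existsLoop (a := 14) (R := {5, 7, 8, 9, 10, 11, 12, 13}) hu3
      ((hu.ireg 0 (by decide)).trans hn) (by decide) (by decide) (by decide)
      fun j hj v hv hvarr hvj => hvj ▸ evaluates_columnProg
        ((hv.ireg 0 (by decide)).trans ((hu.ireg 0 (by decide)).trans hn))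
        ((hv.ireg 2 (by decide)).trans ((hu.ireg 2 (by decide)).trans hm))
        ((hv.ireg 3 (by decide)).trans hu3) (hvarr ▸ htg) (hvj.trans_lt hj)
  exact Runs.weaken hscan le_rfl fun v ⟨_, _, hv⟩ => Runs.op ((v.setI_ireg_self 0 _).trans hv)

end RAM

namespace MaxAlg

variable {n : ℕ}

theorem orbitPeriodic_iff_not_violates {A : Mat n} {g : ℕ → ℕ → ℕ}
    (hg : ∀ i j : Fin n, g i j = lead A i j 1) : OrbitPeriodic A ↔
      ¬ ∃ j < n, ∃ i < n, ∃ k < n, RAM.Violates n (ultCount A) g i j k := by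
  rw [orbitPeriodic_iff]
  simp only [← hg]
  constructor
  · rintro H ⟨j, hj, i, hi, k, hk, hcol, hik, hcol'⟩
    rcases Finset.fold_min_lt _ |>.1 (lt_min hcol hcol') with h | ⟨i', hi', h⟩
    · exact (h.trans_le (min_le_left _ _)).not_gt hik
    · exact (h.trans_le (min_le_right _ _)).not_ge
        (H ⟨i, hi⟩ ⟨i', Finset.mem_range.1 hi'⟩ ⟨j, hj⟩ ⟨k, hk⟩ hik (h.trans_le (min_le_left _ _)))
  · intro H i i' j k hik hi'
    by_contra! hij
    have hcol : ∀ x, g i' j < x → RAM.columnMin n (ultCount A) g j < x := fun x hx =>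
      Finset.fold_min_lt _ |>.2 (Or.inr ⟨i', Finset.mem_range.2 i'.2, hx⟩)
    exact H ⟨j, j.2, i, i.2, k, k.2, hcol _ hi', hik, hcol _ hij⟩

end MaxAlg

theorem theorem7p6_general : ∃ (P : RAM.Prog) (κ : ℕ), ∀ (n : ℕ), 1 ≤ n →
    ∀ (A : MaxAlg.Mat n) (s₀ : RAM.State), s₀.ireg 0 = n → s₀.ireg 2 = MaxAlg.ultCount A →
      (∀ μ < MaxAlg.ultCount A, ∀ i j : Fin n,
        s₀.rarr 2 μ i j = 0 ↔ MaxAlg.ultU A μ 1 i j = 0) →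
      ∃ (s : RAM.State) (T : ℕ), RAM.Exec P s₀ s T ∧ T ≤ κ * n ^ 3 ∧
        (MaxAlg.OrbitPeriodic A → s.ireg 0 = 1) ∧
        (¬ MaxAlg.OrbitPeriodic A → s.ireg 0 = 0) := by
  classical
  refine ⟨RAM.orbitProg, 60, fun n hn1 A s₀ hn hm hzero => ?_⟩
  have hperiodic := MaxAlg.orbitPeriodic_iff_not_violates (A := A)
    (g := fun i j => leastBelow (MaxAlg.ultCount A) fun ν => s₀.rarr 2 ν i j ≠ 0)
    fun i j => (leastBelow_congr fun ν hν => (hzero ν hν i j).not).trans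
      (MaxAlg.lead_one_eq A i j).symm
  obtain ⟨s, T, hexec, hT, hs⟩ :=
    RAM.runs_orbitProg hn hm (MaxAlg.ultCount_le A) hn1 fun _ _ _ _ => rfl
  exact ⟨s, T, hexec, hT, fun h => hs.trans (if_neg (hperiodic.1 h)),
    fun h => hs.trans (if_pos (not_not.1 fun h' => h (hperiodic.2 h')))⟩

theorem theorem7p6 :
    ∃ (P : RAM.Prog) (κ : ℕ), ∀ (n : ℕ), 1 ≤ n →
      ∀ (A : MaxAlg.Mat n) (c : ℕ) (comp : Fin n → Fin c), MaxAlg.IsComponentNumbering A comp →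
        ∃ (s : RAM.State) (T : ℕ), RAM.Exec P (MaxAlg.input A comp) s T ∧ T ≤ κ * n ^ 3 ∧
          (MaxAlg.OrbitPeriodic A → s.ireg 0 = 1) ∧
          (¬ MaxAlg.OrbitPeriodic A → s.ireg 0 = 0) := by
  obtain ⟨P, κ, h⟩ := theorem7p6_general
  exact ⟨P, κ, fun n hn A c comp _ => h n hn A _ rfl rfl fun μ hμ i j => by
    simp [MaxAlg.input, hμ]⟩
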